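/- **Setting.** Let $S\subseteq\mathbb{R}^d$ and let $f$ be a Bregman function with zone $S$. That is, $S$ is non-empty and convex, $f$ is defined on a set containing $\overline S$, is continuous and strictly convex on $\overline S$ and continuously differentiable on $S$, and with $D_f(x,y)=f(x)-f(y)-\langle\nabla f(y),x-y\rangle$ the following hold: - for all $\alpha\in\mathbb{R}$, $x\in\overline S$, $y\in S$, the sets $\{x'\in\overline S: D_f(x',y)\le\alpha\}$ and $\{y'\in S: D_f(x,y')\le\alpha\}$ are bounded; - if $y_n\in S$ and $y_n\to y^*$, then $D_f(y^*,y_n)\to0$; - if $y_n\in S$, $x_n\in\overline S$, $D_f(x_n,y_n)\to 0$, $y_n\to y^*$ and $(x_n)$ is bounded, then $x_n\to y^*$. Let $H_i=\{x:\langle a_i,x\rangle\le b_i\}$, $a_i\ne0$, be a finite family of half-spaces and $C=\bigcap_i H_i$. Assume that every hyperplane $\partial H_i=\{x:\langle a_i,x\rangle= b_i\}$ is strongly zone consistent: for every $y\in S$ and every hyperplane $H'$ parallel to $\partial H_i$ and lying between $y$ and $\partial H_i$ (with $\partial H_i$ included), the Bregman projection $\operatorname{argmin}_{w\in H'\cap\overline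 S}D_f(w,y)$ exists and lies in $S$. Assume that there is $x^0\in S$ with $\nabla f(x^0)=0$. **Oracles.** A deterministic separation oracle is a map $Q$ from $\mathbb{R}^d$ to lists of constraints for which there is a continuous non-decreasing $\varphi:[0,\infty)\to[0,\infty)$ with $\varphi(0)=0$ and $\varphi(t)>0$ for $t>0$ such that, for every $x\notin C$, some $H_i\in Q(x)$ satisfies $\operatorname{dist}(x,H_i)\ge\varphi(\operatorname{dist}(x,C))$. A random separation oracle returns on input $x$ a random list, and there is $\tau>0$ such that for every $x$ each constraint belongs to this list with probability at least $\tau$. **Algorithm (Project and Forget).** Start with $x^{(0)}\in S$ such that $\nabla f(x^{(0)})=0$, $z^{(0)}=0$ and $L^{(0)}=\emptyset$. In iteration $\nu=0,1,2,\dots$ call the oracle at $x^{(\nu)}$ to obtain a list $L$ (for a random oracle, a fresh list, whose law given the past is that of the oracle at $x^{(\nu)}$) and put $\tilde L=L^{(\nu)}\cup L$. Starting from $(x,z)=(x^{(\nu)},z^{(\nu)})$, process each constraint $i\in\tilde L$ once, in any order (for a random oracle, chosen without knowledge of later lists), as follows: find $p\in S\cap\partial H_i$ and $\theta\in\mathbb{R}$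 with $\nabla f(p)-\nabla f(x)=\theta a_i$, put $c=\min(z_i,\theta)$, replace $x$ by the point $x'\in S$ with $\nabla f(x')-\nabla f(x)=c\,a_i$, and replace $z_i$ by $z_i-c$. The result is $(x^{(\nu+1)},z^{(\nu+1)})$. Finally $L^{(\nu+1)}$ consists of those $i\in\tilde L$ with $z_i^{(\nu+1)}\neq0$. **Statement.** Let $x^*$ be the optimal solution of: minimize $f(x)$ over $x\in C\cap\overline S$. Suppose that $f$ is twice differentiable at $x^*$ and that its Hessian $Hf(x^*)$ is positive definite. 1. If the oracle is a deterministic separation oracle, then for every sequence produced by the algorithm there is $z^*$ such that the dual variables converge to $z^*$, both as the sequence $z^{(\nu)}$ of their values after the iterations and as the sequence of their values after the single projections. 2. If the oracle is a random separation oracle, then with probability $1$ there is such a $z^*$. -/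

import Mathlib

open Set Filter Topology MeasureTheory
open scoped RealInnerProductSpace ENNReal

noncomputable section

/-- Generalized Bregman distance `D_f(x, y) = f x - f y - ⟪∇f y, x - y⟫`. -/
def bregmanDist {d : ℕ} (f : EuclideanSpace ℝ (Fin d) → ℝ)
    (x y : EuclideanSpace ℝ (Fin d)) : ℝ :=
  f x - f y - ⟪gradient f y, x - y⟫

/-- `f` is a Bregman function with zone `S`. The Bregman domain of `f` is `closure S`.
`f` is a total function, with any values away from the larger set on which it is given. -/
structure IsBregmanFunction {d : ℕ} (f : EuclideanSpace ℝ (Fin d) → ℝ)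
    (S : Set (EuclideanSpace ℝ (Fin d))) : Prop where
  nonempty : S.Nonempty
  convex : Convex ℝ S
  continuousOn : ContinuousOn f (closure S)
  strictConvexOn : StrictConvexOn ℝ (closure S) f
  differentiableAt : ∀ x ∈ S, DifferentiableAt ℝ f x
  continuousOn_gradient : ContinuousOn (gradient f) S
  bounded_left : ∀ y ∈ S, ∀ α : ℝ,
    Bornology.IsBounded {x | x ∈ closure S ∧ bregmanDist f x y ≤ α}
  bounded_right : ∀ x ∈ closure S, ∀ α : ℝ,
    Bornology.IsBounded {y | y ∈ S ∧ bregmanDist f x y ≤ α}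
  tendsto_dist : ∀ (y : ℕ → EuclideanSpace ℝ (Fin d)) (y' : EuclideanSpace ℝ (Fin d)),
    (∀ n, y n ∈ S) → Tendsto y atTop (𝓝 y') →
      Tendsto (fun n => bregmanDist f y' (y n)) atTop (𝓝 0)
  tendsto_of_dist : ∀ (x y : ℕ → EuclideanSpace ℝ (Fin d)) (y' : EuclideanSpace ℝ (Fin d)),
    (∀ n, y n ∈ S) → (∀ n, x n ∈ closure S) →
      Tendsto (fun n => bregmanDist f (x n) (y n)) atTop (𝓝 0) →
      Tendsto y atTop (𝓝 y') → Bornology.IsBounded (range x) → Tendsto x atTop (𝓝 y')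

/-- `p` is the Bregman projection of `y` onto the set `K`: the minimizer of `D_f(·, y)` over the
part of `K` in the domain `closure S`. -/
def IsBregmanProjection {d : ℕ} (f : EuclideanSpace ℝ (Fin d) → ℝ)
    (S K : Set (EuclideanSpace ℝ (Fin d))) (y p : EuclideanSpace ℝ (Fin d)) : Prop :=
  p ∈ K ∩ closure S ∧ IsMinOn (fun w => bregmanDist f w y) (K ∩ closure S) p

/-- The hyperplane `{w | ⟪a, w⟫ = β}`. -/
def hyperplane {d : ℕ} (a : EuclideanSpace ℝ (Fin d)) (β : ℝ) :
    Set (EuclideanSpace ℝ (Fin d)) := {w | ⟪a, w⟫ = β}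

/-- The half-space `{w | ⟪a, w⟫ ≤ β}`. -/
def halfSpace {d : ℕ} (a : EuclideanSpace ℝ (Fin d)) (β : ℝ) :
    Set (EuclideanSpace ℝ (Fin d)) := {w | ⟪a, w⟫ ≤ β}

/-- The hyperplane `⟪a, ·⟫ = b` is strongly zone consistent: for every `y ∈ S` and every parallel
hyperplane lying between `y` and it (ends included), the Bregman projection of `y` onto that
hyperplane lies in `S`. -/
def StronglyZoneConsistent {d : ℕ} (f : EuclideanSpace ℝ (Fin d) → ℝ)
    (S : Set (EuclideanSpace ℝ (Fin d))) (a : EuclideanSpace ℝ (Fin d)) (b : ℝ) : Prop :=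
  ∀ y ∈ S, ∀ β ∈ uIcc ⟪a, y⟫ b, ∃ p ∈ S, IsBregmanProjection f S (hyperplane a β) y p

/-- The feasible region `C`, the intersection of the half-spaces. -/
def feasibleRegion {d : ℕ} {ι : Type*} (a : ι → EuclideanSpace ℝ (Fin d)) (b : ι → ℝ) :
    Set (EuclideanSpace ℝ (Fin d)) := ⋂ i, halfSpace (a i) (b i)

/-- `x'` is an optimal solution: it minimizes `f` over the feasible points of its domain. -/
def IsOptimalSolution {d : ℕ} {ι : Type*} (f : EuclideanSpace ℝ (Fin d) → ℝ)
    (S : Set (EuclideanSpace ℝ (Fin d))) (a : ι → EuclideanSpace ℝ (Fin d)) (b : ι → ℝ)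
    (x' : EuclideanSpace ℝ (Fin d)) : Prop :=
  x' ∈ feasibleRegion a b ∩ closure S ∧ IsMinOn f (feasibleRegion a b ∩ closure S) x'

/-- `f` is twice differentiable at `x`. -/
def TwiceDifferentiableAt {d : ℕ} (f : EuclideanSpace ℝ (Fin d) → ℝ)
    (x : EuclideanSpace ℝ (Fin d)) : Prop :=
  (∀ᶠ w in 𝓝 x, DifferentiableAt ℝ f w) ∧ DifferentiableAt ℝ (gradient f) x

/-- The Hessian of `f` at `x`, as the derivative of the gradient. -/
def hessian {d : ℕ} (f : EuclideanSpace ℝ (Fin d) → ℝ) (x : EuclideanSpace ℝ (Fin d)) :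
    EuclideanSpace ℝ (Fin d) →L[ℝ] EuclideanSpace ℝ (Fin d) :=
  fderiv ℝ (gradient f) x

/-- `Q` is a deterministic separation oracle. Nothing is asked of the list returned at `x ∈ C`
(an oracle that merely certifies `x ∈ C` is one returning the empty list there). -/
def IsSeparationOracle {d : ℕ} {ι : Type*} (a : ι → EuclideanSpace ℝ (Fin d)) (b : ι → ℝ)
    (Q : EuclideanSpace ℝ (Fin d) → Finset ι) : Prop :=
  ∃ φ : ℝ → ℝ, φ 0 = 0 ∧ (∀ t, 0 < t → 0 < φ t) ∧ MonotoneOn φ (Ici 0) ∧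
    ContinuousOn φ (Ici 0) ∧
    ∀ x, x ∉ feasibleRegion a b →
      ∃ i ∈ Q x, φ (Metric.infDist x (feasibleRegion a b)) ≤
        Metric.infDist x (halfSpace (a i) (b i))

/-- `Q` is a random separation oracle: `Q x` is the law of the list returned on input `x`, and each
constraint belongs to this list with probability at least `τ > 0`. -/
def IsRandomSeparationOracle {d : ℕ} {ι : Type*}
    (Q : EuclideanSpace ℝ (Fin d) → PMF (Finset ι)) : Prop :=
  ∃ τ : ℝ≥0∞, 0 < τ ∧ ∀ x i, τ ≤ (Q x).toOuterMeasure {L | i ∈ L}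

/-- One pass of the loop body of `Project`, for the constraint `i`, from `(x, z)` to `(x', z')`:
`p`, `θ` solve `∇f p - ∇f x = θ a_i`, `p ∈ H_i`, and the correction is `c = min (z_i) θ`. As `∇f` is
a function on the zone `S`, the points `p` and `x'` are sought in `S`. -/
def ProjectStep {d : ℕ} {ι : Type*} [DecidableEq ι] (f : EuclideanSpace ℝ (Fin d) → ℝ)
    (S : Set (EuclideanSpace ℝ (Fin d))) (a : ι → EuclideanSpace ℝ (Fin d)) (b : ι → ℝ) (i : ι)
    (x : EuclideanSpace ℝ (Fin d)) (z : ι → ℝ)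
    (x' : EuclideanSpace ℝ (Fin d)) (z' : ι → ℝ) : Prop :=
  ∃ p ∈ S, ∃ θ : ℝ, p ∈ hyperplane (a i) (b i) ∧ gradient f p - gradient f x = θ • a i ∧
    x' ∈ S ∧ gradient f x' - gradient f x = min (z i) θ • a i ∧
    z' = Function.update z i (z i - min (z i) θ)

/-- The record of an execution. In iteration `ν`, `order ν` lists the constraints in the order in
which they are projected onto; `xInner ν k` and `zInner ν k` are the primal and dual variables after
`k` projections of that iteration (`k ≤ (order ν).length`), and `active ν` is the list `L^(ν)` of
remembered constraints at its beginning. -/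
structure Trace (d : ℕ) (ι : Type*) where
  xInner : ℕ → ℕ → EuclideanSpace ℝ (Fin d)
  zInner : ℕ → ℕ → ι → ℝ
  active : ℕ → Finset ι
  order : ℕ → List ι

/-- The primal iterate `x^(ν)`. -/
def Trace.x {d : ℕ} {ι : Type*} (T : Trace d ι) (ν : ℕ) : EuclideanSpace ℝ (Fin d) := T.xInner ν 0

/-- The dual iterate `z^(ν)`. -/
def Trace.z {d : ℕ} {ι : Type*} (T : Trace d ι) (ν : ℕ) : ι → ℝ := T.zInner ν 0

/-- `T` is an execution of Project and Forget in which the oracle returns the list `out ν` in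
iteration `ν`. The constraints of `active ν ∪ out ν` are projected onto once each, in any order;
then those with a zero dual variable are forgotten. -/
structure IsProjectForgetRun {d : ℕ} {ι : Type*} [DecidableEq ι]
    (f : EuclideanSpace ℝ (Fin d) → ℝ) (S : Set (EuclideanSpace ℝ (Fin d)))
    (a : ι → EuclideanSpace ℝ (Fin d)) (b : ι → ℝ) (out : ℕ → Finset ι) (T : Trace d ι) :
    Prop where
  init_mem : T.x 0 ∈ S
  init_gradient : gradient f (T.x 0) = 0
  init_z : T.z 0 = 0
  init_active : T.active 0 = ∅
  order_nodup : ∀ ν, (T.order ν).Nodup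
  order_toFinset : ∀ ν, (T.order ν).toFinset = T.active ν ∪ out ν
  project : ∀ ν k, ∀ hk : k < (T.order ν).length,
    ProjectStep f S a b ((T.order ν)[k]) (T.xInner ν k) (T.zInner ν k)
      (T.xInner ν (k + 1)) (T.zInner ν (k + 1))
  next_x : ∀ ν, T.x (ν + 1) = T.xInner ν (T.order ν).length
  next_z : ∀ ν, T.z (ν + 1) = T.zInner ν (T.order ν).length
  forget : ∀ ν, T.active (ν + 1) = {i ∈ T.active ν ∪ out ν | T.z (ν + 1) i ≠ 0}

/-- `T` is a random execution of Project and Forget with the random oracle `Q`: `out ν` is the list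
returned in iteration `ν`, `ℱ ν` is the information available when the oracle is called in iteration
`ν` (it determines `x^(ν)` and the earlier lists), and given this information the list has the law
`Q (x^(ν))`. -/
structure IsRandomProjectForgetRun {d : ℕ} {ι : Type*} [DecidableEq ι]
    (f : EuclideanSpace ℝ (Fin d) → ℝ) (S : Set (EuclideanSpace ℝ (Fin d)))
    (a : ι → EuclideanSpace ℝ (Fin d)) (b : ι → ℝ)
    (Q : EuclideanSpace ℝ (Fin d) → PMF (Finset ι))
    {Ω : Type*} [mΩ : MeasurableSpace Ω] (P : Measure Ω) (ℱ : Filtration ℕ mΩ)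
    (out : ℕ → Ω → Finset ι) (T : Ω → Trace d ι) : Prop where
  run : ∀ ω, IsProjectForgetRun f S a b (fun ν => out ν ω) (T ω)
  measurable_x : ∀ ν, Measurable[ℱ ν] (fun ω => (T ω).x ν)
  measurable_out : ∀ ν L, MeasurableSet[ℱ (ν + 1)] {ω | out ν ω = L}
  law_out : ∀ ν L, P[{ω | out ν ω = L}.indicator (fun _ => (1 : ℝ)) | ℱ ν] =ᵐ[P]
    fun ω => (Q ((T ω).x ν) L).toReal

/-- The dual variables of `T` converge to `z'`: after the iterations, and also, uniformly over the
position within an iteration, after the single projections. -/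
def DualConvergesTo {d : ℕ} {ι : Type*} [Fintype ι] (T : Trace d ι) (z' : ι → ℝ) : Prop :=
  Tendsto T.z atTop (𝓝 z') ∧
    ∀ ε > 0, ∃ N, ∀ ν ≥ N, ∀ k ≤ (T.order ν).length, dist (T.zInner ν k) z' < ε

end

/-! Project and Forget is coordinate ascent on the dual. Each pair (x, z) satisfies ∇f x = -∑ z_i
a_i with z ≥ 0 (`DualPair`), so `lagrangian` at (x, z) is the dual value, and a projection raises it
by at least D_f(x', x) (`DualPair.projectStep`). By weak duality the gap f(x*) - `lagrangian` is
nonnegative and dominates D_f(x*, x). Hence the iterates are bounded, the gains tend to 0, and all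
points within an iteration merge.

A constraint returned by the oracle is met right after its projection, hence asymptotically at x^(ν)
as well. The oracle hypothesis extends this to all constraints: through φ if it is deterministic,
through a conditional Borel–Cantelli argument if it is random. Then the gap tends to 0, the iterates
tend to x*, and the dual variables of constraints slack at x* vanish after finitely many iterations.
From then on the gap equals D_f(x*, x), which is comparable to r² with r = ‖x - x*‖.

The core is `exists_linear_rate`. If no linear rate held, then along some ultrafilter the relative
decrease of the gap would tend to 0, so steps and gradient changes would be o(r). Let u be the limit
of (x - x*)/r. A constraint with ⟪a_i, u⟫ < 0 ends its projection slack, so its dual variable is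
removed entirely and was already o(r); a constraint with ⟪a_i, u⟫ > 0 carries no dual variable. Thus
every z_i ⟪a_i, u⟫ is o(r) and nonpositive, and stationarity yields ⟪∇f x*, u⟫ ≥ 0 and then ⟪Hu, u⟫
≤ 0, against positive definiteness.

Finally, an iteration moves z by at most a constant times the square root of the gap
(`exists_dist_zInner_le`), which is summable at a linear rate, so z is Cauchy. No independence of
the a_i enters. -/

/-! ### Bregman distances -/

section Bregman

variable {d : ℕ} {f : EuclideanSpace ℝ (Fin d) → ℝ} {S : Set (EuclideanSpace ℝ (Fin d))}

theorem bregmanDist_self (x : EuclideanSpace ℝ (Fin d)) : bregmanDist f x x = 0 := by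
  simp [bregmanDist]

theorem bregmanDist_add_bregmanDist_symm (x y : EuclideanSpace ℝ (Fin d)) :
    bregmanDist f x y + bregmanDist f y x = ⟪gradient f x - gradient f y, x - y⟫ := by
  simp only [bregmanDist, inner_sub_left, inner_sub_right]
  ring

/-- The three-point identity. -/
theorem bregmanDist_eq_add (x w y : EuclideanSpace ℝ (Fin d)) :
    bregmanDist f x y = bregmanDist f x w + bregmanDist f w y
      + ⟪gradient f w - gradient f y, x - w⟫ := by
  simp only [bregmanDist, inner_sub_left, inner_sub_right]
  ring

/-- A convex function lies above its tangent. The base point may lie in `closure S` outside `S`,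
because this is later applied at the optimal solution and at midpoints near it. -/
theorem IsBregmanFunction.bregmanDist_nonneg (hf : IsBregmanFunction f S)
    {x y : EuclideanSpace ℝ (Fin d)} (hx : x ∈ closure S) (hy : y ∈ closure S)
    (hd : DifferentiableAt ℝ f y) : 0 ≤ bregmanDist f x y := by
  have hc := hf.strictConvexOn.convexOn.comp_affineMap (AffineMap.lineMap y x : ℝ →ᵃ[ℝ] _)
  have h0 : (0 : ℝ) ∈ (AffineMap.lineMap y x : ℝ →ᵃ[ℝ] _) ⁻¹' closure S := by simpa using hy
  have h1 : (1 : ℝ) ∈ (AffineMap.lineMap y x : ℝ →ᵃ[ℝ] _) ⁻¹' closure S := by simpa using hx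
  have hl : HasDerivAt (AffineMap.lineMap y x : ℝ →ᵃ[ℝ] EuclideanSpace ℝ (Fin d)) (x - y) 0 :=
    AffineMap.hasDerivAt_lineMap
  have hg : HasFDerivAt f (InnerProductSpace.toDual ℝ _ (gradient f y))
      ((AffineMap.lineMap y x : ℝ →ᵃ[ℝ] EuclideanSpace ℝ (Fin d)) 0) := by
    simpa using hasGradientAt_iff_hasFDerivAt.mp hd.hasGradientAt
  have h := hc.le_slope_of_hasDerivAt h0 h1 one_pos (hg.comp_hasDerivAt 0 hl)
  simp only [slope_def_field, Function.comp_apply, AffineMap.lineMap_apply_one,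
    AffineMap.lineMap_apply_zero, InnerProductSpace.toDual_apply_apply, sub_zero, div_one] at h
  exact sub_nonneg.mpr h

/-- Otherwise strict convexity would make the distance from the midpoint to `y` negative. -/
theorem IsBregmanFunction.eq_of_bregmanDist_eq_zero (hf : IsBregmanFunction f S)
    {x y : EuclideanSpace ℝ (Fin d)} (hx : x ∈ closure S) (hy : y ∈ closure S)
    (hd : DifferentiableAt ℝ f y) (h : bregmanDist f x y = 0) : x = y := by
  by_contra hne
  have hs := hf.strictConvexOn.2 hx hy hne (by norm_num : (0 : ℝ) < 1 / 2)
    (by norm_num : (0 : ℝ) < 1 / 2) (by norm_num)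
  have hw := hf.convex.closure hx hy (a := 1 / 2) (b := 1 / 2) (by norm_num) (by norm_num)
    (by norm_num)
  have h0 := hf.bregmanDist_nonneg hw hy hd
  simp only [bregmanDist] at h h0
  have : (1 / 2 : ℝ) • x + (1 / 2 : ℝ) • y - y = (1 / 2 : ℝ) • (x - y) := by module
  rw [this, inner_smul_right] at h0
  simp only [smul_eq_mul] at hs
  linarith

theorem IsBregmanFunction.gradient_injOn (hf : IsBregmanFunction f S) :
    InjOn (gradient f) S := by
  intro x hx y hy h
  have h1 := bregmanDist_add_bregmanDist_symm (f := f) x y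
  rw [h, sub_self, inner_zero_left] at h1
  have hx' := subset_closure hx
  have hy' := subset_closure hy
  have h2 := hf.bregmanDist_nonneg hx' hy' (hf.differentiableAt y hy)
  have h3 := hf.bregmanDist_nonneg hy' hx' (hf.differentiableAt x hx)
  exact hf.eq_of_bregmanDist_eq_zero hx' hy' (hf.differentiableAt y hy) (by linarith)

theorem IsBregmanFunction.inner_gradient_sub_nonneg (hf : IsBregmanFunction f S)
    {x y : EuclideanSpace ℝ (Fin d)} (hx : x ∈ S) (hy : y ∈ S) :
    0 ≤ ⟪gradient f x - gradient f y, x - y⟫ := by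
  rw [← bregmanDist_add_bregmanDist_symm]
  exact add_nonneg
    (hf.bregmanDist_nonneg (subset_closure hx) (subset_closure hy) (hf.differentiableAt y hy))
    (hf.bregmanDist_nonneg (subset_closure hy) (subset_closure hx) (hf.differentiableAt x hx))

/-- Filter form of the condition `tendsto_dist`. -/
theorem IsBregmanFunction.tendsto_bregmanDist (hf : IsBregmanFunction f S) {α : Type*}
    {l : Filter α} {y : α → EuclideanSpace ℝ (Fin d)} {y' : EuclideanSpace ℝ (Fin d)}
    (hy : ∀ᶠ n in l, y n ∈ S) (h : Tendsto y l (𝓝 y')) :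
    Tendsto (fun n => bregmanDist f y' (y n)) l (𝓝 0) := by
  -- `𝓝[S] y'` is countably generated, so sequences decide; any other filter, in particular an
  -- ultrafilter, then factors through it.
  have key : Tendsto (fun w => bregmanDist f y' w) (𝓝[S] y') (𝓝 0) := by
    refine tendsto_of_seq_tendsto fun u hu => ?_
    obtain ⟨hu1, hu2⟩ := tendsto_nhdsWithin_iff.mp hu
    obtain ⟨N, hN⟩ := eventually_atTop.mp hu2
    rw [← tendsto_add_atTop_iff_nat N]
    exact hf.tendsto_dist (fun n => u (n + N)) y' (fun n => hN _ (Nat.le_add_left _ _))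
      ((tendsto_add_atTop_iff_nat N).mpr hu1)
  exact key.comp (tendsto_nhdsWithin_iff.mpr ⟨h, hy⟩)

/-- Filter form of the condition `tendsto_of_dist`. -/
theorem IsBregmanFunction.tendsto_of_tendsto_bregmanDist (hf : IsBregmanFunction f S) {α : Type*}
    {l : Filter α} {x y : α → EuclideanSpace ℝ (Fin d)} {y' : EuclideanSpace ℝ (Fin d)}
    {B : Set (EuclideanSpace ℝ (Fin d))} (hB : Bornology.IsBounded B)
    (hy : ∀ᶠ n in l, y n ∈ S) (hx : ∀ᶠ n in l, x n ∈ closure S) (hxB : ∀ᶠ n in l, x n ∈ B)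
    (hd : Tendsto (fun n => bregmanDist f (x n) (y n)) l (𝓝 0)) (h : Tendsto y l (𝓝 y')) :
    Tendsto x l (𝓝 y') := by
  -- `F` is the largest filter on pairs that satisfies the hypotheses; it is countably generated, so
  -- it can be tested on sequences.
  let F : Filter (EuclideanSpace ℝ (Fin d) × EuclideanSpace ℝ (Fin d)) :=
    (𝓟 ((closure S ∩ B) ×ˢ S) ⊓ comap (fun q => bregmanDist f q.1 q.2) (𝓝 0)) ⊓
      comap Prod.snd (𝓝 y')
  have key : Tendsto Prod.fst F (𝓝 y') := by
    refine tendsto_of_seq_tendsto fun u hu => ?_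
    simp only [F, tendsto_inf, tendsto_principal, tendsto_comap_iff] at hu
    obtain ⟨⟨hu1, hu2⟩, hu3⟩ := hu
    obtain ⟨N, hN⟩ := eventually_atTop.mp hu1
    rw [← tendsto_add_atTop_iff_nat N]
    refine hf.tendsto_of_dist (fun n => (u (n + N)).1) (fun n => (u (n + N)).2) y'
      (fun n => (hN _ (Nat.le_add_left _ _)).2) (fun n => (hN _ (Nat.le_add_left _ _)).1.1)
      ((tendsto_add_atTop_iff_nat N).mpr hu2) ((tendsto_add_atTop_iff_nat N).mpr hu3)
      (hB.subset ?_)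
    rintro _ ⟨n, rfl⟩
    exact (hN _ (Nat.le_add_left _ _)).1.2
  have hF : Tendsto (fun n => (x n, y n)) l F := by
    simp only [F, tendsto_inf, tendsto_principal, tendsto_comap_iff]
    refine ⟨⟨?_, hd⟩, h⟩
    filter_upwards [hy, hx, hxB] with n h1 h2 h3 using ⟨⟨h2, h3⟩, h1⟩
  exact key.comp hF

end Bregman

theorem mem_feasibleRegion_iff {d : ℕ} {ι : Type*} {a : ι → EuclideanSpace ℝ (Fin d)}
    {b : ι → ℝ} {x : EuclideanSpace ℝ (Fin d)} :
    x ∈ feasibleRegion a b ↔ ∀ i, ⟪a i, x⟫ ≤ b i := by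
  simp [feasibleRegion, halfSpace]

/-! ### Dual pairs and the gain of one projection -/

section Lagrangian

variable {d : ℕ} {ι : Type*} [Fintype ι] {f : EuclideanSpace ℝ (Fin d) → ℝ}
  {S : Set (EuclideanSpace ℝ (Fin d))} {a : ι → EuclideanSpace ℝ (Fin d)} {b : ι → ℝ}

/-- The Lagrangian of the problem: minimize `f` subject to `⟪a i, x⟫ ≤ b i`. -/
noncomputable def lagrangian (f : EuclideanSpace ℝ (Fin d) → ℝ) (a : ι → EuclideanSpace ℝ (Fin d))
    (b : ι → ℝ) (x : EuclideanSpace ℝ (Fin d)) (z : ι → ℝ) : ℝ :=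
  f x + ∑ i, z i * (⟪a i, x⟫ - b i)

/-- `x` is the stationary point of the Lagrangian at `z`, in the zone, and `z` is dual feasible. -/
structure DualPair (f : EuclideanSpace ℝ (Fin d) → ℝ) (S : Set (EuclideanSpace ℝ (Fin d)))
    (a : ι → EuclideanSpace ℝ (Fin d)) (x : EuclideanSpace ℝ (Fin d)) (z : ι → ℝ) : Prop where
  mem : x ∈ S
  nonneg : ∀ i, 0 ≤ z i
  gradient_eq : gradient f x = -∑ i, z i • a i

theorem DualPair.inner_gradient {x : EuclideanSpace ℝ (Fin d)} {z : ι → ℝ}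
    (h : DualPair f S a x z) (v : EuclideanSpace ℝ (Fin d)) :
    ⟪gradient f x, v⟫ = -∑ i, z i * ⟪a i, v⟫ := by
  simp [h.gradient_eq, inner_neg_left, sum_inner, inner_smul_left]

/-- The Lagrangian at `z` differs from `f` by an affine function and is stationary at `x`, so it
grows by exactly D_f(w, x) from `x` to `w`. A feasible `w` gives weak duality; `w = x'` gives the
gain of a projection. -/
theorem DualPair.sub_lagrangian {x : EuclideanSpace ℝ (Fin d)} {z : ι → ℝ}
    (h : DualPair f S a x z) (w : EuclideanSpace ℝ (Fin d)) :
    f w - lagrangian f a b x z = bregmanDist f w x + ∑ i, z i * (b i - ⟪a i, w⟫) := by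
  simp only [lagrangian, bregmanDist, h.inner_gradient]
  have : ∑ i, z i * ⟪a i, w - x⟫ =
      -∑ i, z i * (b i - ⟪a i, w⟫) - ∑ i, z i * (⟪a i, x⟫ - b i) := by
    rw [← Finset.sum_neg_distrib, ← Finset.sum_sub_distrib]
    refine Finset.sum_congr rfl fun i _ => ?_
    rw [inner_sub_right]; ring
  rw [this]; ring

theorem DualPair.bregmanDist_le {x w : EuclideanSpace ℝ (Fin d)} {z : ι → ℝ}
    (h : DualPair f S a x z) (hw : w ∈ feasibleRegion a b) :
    bregmanDist f w x ≤ f w - lagrangian f a b x z := by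
  rw [h.sub_lagrangian w]
  refine le_add_of_nonneg_right (Finset.sum_nonneg fun i _ => mul_nonneg (h.nonneg i) ?_)
  exact sub_nonneg.mpr (mem_feasibleRegion_iff.mp hw i)

/-- What a pass of the loop body does to a dual pair. -/
theorem DualPair.projectStep [DecidableEq ι] (hf : IsBregmanFunction f S) {i : ι}
    {x x' : EuclideanSpace ℝ (Fin d)} {z z' : ι → ℝ} (h : DualPair f S a x z)
    (hs : ProjectStep f S a b i x z x' z') :
    DualPair f S a x' z' ∧ ⟪a i, x'⟫ ≤ b i ∧ (z' i = 0 ∨ ⟪a i, x'⟫ = b i) ∧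
      (∀ j, j ≠ i → z' j = z j) ∧ gradient f x' - gradient f x = (z i - z' i) • a i ∧
      bregmanDist f x' x ≤ lagrangian f a b x' z' - lagrangian f a b x z := by
  obtain ⟨p, hp, θ, hpH, hpg, hx', hxg, hz'⟩ := hs
  set c := min (z i) θ with hc
  have hzi : z' i = z i - c := by simp [hz']
  have hzj : ∀ j, j ≠ i → z' j = z j := fun j hj => by simp [hz', hj]
  have hci : c ≤ z i := min_le_left _ _
  have hcθ : c ≤ θ := min_le_right _ _
  have hpH' : ⟪a i, p⟫ = b i := hpH
  -- Either the correction is truncated by `z i`, or it is the full projection.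
  have hcase : (c = z i ∧ c < θ) ∨ c = θ := by
    rcases hcθ.lt_or_eq with h1 | h1
    · exact Or.inl ⟨(min_choice (z i) θ).resolve_right (by rw [← hc]; exact h1.ne), h1⟩
    · exact Or.inr h1
  have hle : ⟪a i, x'⟫ ≤ b i ∧ (z' i = 0 ∨ ⟪a i, x'⟫ = b i) := by
    rcases hcase with ⟨h1, h2⟩ | h1
    -- A truncated step stops short of `p`; monotonicity of the gradient places `x'` on the feasible
    -- side.
    · refine ⟨?_, Or.inl (by rw [hzi, h1, sub_self])⟩
      have h3 := hf.inner_gradient_sub_nonneg hp hx'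
      have h4 : gradient f p - gradient f x' = (θ - c) • a i := by
        rw [sub_smul, ← hpg, ← hxg]; abel
      rw [h4, inner_smul_left, inner_sub_right, hpH'] at h3
      have := nonneg_of_mul_nonneg_right (b := b i - ⟪a i, x'⟫) (by simpa using h3)
        (sub_pos.mpr h2)
      linarith
    · have : x' = p := hf.gradient_injOn hx' hp (by
        rw [h1, ← hpg] at hxg
        exact sub_left_injective hxg)
      rw [this]
      exact ⟨hpH'.le, Or.inr hpH'⟩
  have hsum : ∀ g : ι → ℝ, ∑ j, z' j * g j = ∑ j, z j * g j - c * g i := by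
    intro g
    rw [← Finset.add_sum_erase _ _ (Finset.mem_univ i),
      ← Finset.add_sum_erase (a := i) _ (fun j => z j * g j) (Finset.mem_univ i), hzi,
      Finset.sum_congr rfl fun j hj => by rw [hzj j (Finset.ne_of_mem_erase hj)]]
    ring
  have hpair : DualPair f S a x' z' := by
    refine ⟨hx', fun j => ?_, ?_⟩
    · by_cases hj : j = i
      · rw [hj, hzi]; linarith
      · rw [hzj j hj]; exact h.nonneg j
    · refine ext_inner_right ℝ fun v => ?_
      have : gradient f x' = gradient f x + c • a i := by rw [← hxg]; abel
      rw [this, inner_add_left, h.inner_gradient, inner_smul_left, inner_neg_left, sum_inner]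
      simp only [inner_smul_left, RCLike.conj_to_real]
      rw [hsum fun j => ⟪a j, v⟫]
      ring
  refine ⟨hpair, hle.1, hle.2, hzj, by rw [hxg, hzi, sub_sub_cancel], ?_⟩
  have h1 := h.sub_lagrangian (b := b) x'
  have h2 : f x' - lagrangian f a b x' z' = ∑ j, z' j * (b j - ⟪a j, x'⟫) := by
    rw [hpair.sub_lagrangian (b := b) x', bregmanDist_self, zero_add]
  rw [hsum fun j => b j - ⟪a j, x'⟫] at h2
  -- The gain is exactly D_f(x', x) plus this term. If the slack is not 0 then `z' i = 0`, so `c = z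
  -- i ≥ 0`.
  have h3 : 0 ≤ c * (b i - ⟪a i, x'⟫) := by
    rcases hcase with ⟨h4, -⟩ | h4
    · exact mul_nonneg (h4 ▸ h.nonneg i) (sub_nonneg.mpr hle.1)
    · rcases hle.2 with h5 | h5
      · have : c = z i := by linarith
        exact mul_nonneg (this ▸ h.nonneg i) (sub_nonneg.mpr hle.1)
      · simp [h5]
  linarith

end Lagrangian

/-! ### Monotonicity of the dual value and convergence of the primal iterates -/

section Run

variable {d : ℕ} {ι : Type*} [DecidableEq ι] {f : EuclideanSpace ℝ (Fin d) → ℝ}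
  {S : Set (EuclideanSpace ℝ (Fin d))} {a : ι → EuclideanSpace ℝ (Fin d)} {b : ι → ℝ}
  {out : ℕ → Finset ι} {T : Trace d ι}

namespace IsProjectForgetRun

theorem mem_order_iff (h : IsProjectForgetRun f S a b out T) {ν : ℕ} {i : ι} :
    i ∈ T.order ν ↔ i ∈ T.active ν ∨ i ∈ out ν := by
  rw [← List.mem_toFinset, h.order_toFinset, Finset.mem_union]

variable [Fintype ι]

theorem length_le (h : IsProjectForgetRun f S a b out T) (ν : ℕ) :
    (T.order ν).length ≤ Fintype.card ι :=
  (h.order_nodup ν).length_le_card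

theorem dualPair_of_zero (h : IsProjectForgetRun f S a b out T) (hf : IsBregmanFunction f S)
    {ν : ℕ} (h0 : DualPair f S a (T.x ν) (T.z ν)) {k : ℕ} (hk : k ≤ (T.order ν).length) :
    DualPair f S a (T.xInner ν k) (T.zInner ν k) := by
  induction k with
  | zero => exact h0
  | succ k ih => exact ((ih (Nat.le_of_succ_le hk)).projectStep hf (h.project ν k hk)).1

theorem dualPair (h : IsProjectForgetRun f S a b out T) (hf : IsBregmanFunction f S) (ν : ℕ) :
    DualPair f S a (T.x ν) (T.z ν) := by
  induction ν with
  | zero =>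
    refine ⟨h.init_mem, fun i => ?_, ?_⟩
    · simp [h.init_z]
    · simp [h.init_z, h.init_gradient]
  | succ ν ih =>
    rw [h.next_x, h.next_z]
    exact h.dualPair_of_zero hf ih le_rfl

theorem dualPair_inner (h : IsProjectForgetRun f S a b out T) (hf : IsBregmanFunction f S)
    {ν k : ℕ} (hk : k ≤ (T.order ν).length) :
    DualPair f S a (T.xInner ν k) (T.zInner ν k) :=
  h.dualPair_of_zero hf (h.dualPair hf ν) hk

theorem zInner_eq (h : IsProjectForgetRun f S a b out T) (hf : IsBregmanFunction f S)
    {ν : ℕ} {i : ι} {p q : ℕ} (hpq : p ≤ q) (hq : q ≤ (T.order ν).length)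
    (hi : ∀ k, p ≤ k → ∀ hk : k < q, (T.order ν)[k] ≠ i) :
    T.zInner ν q i = T.zInner ν p i := by
  induction q, hpq using Nat.le_induction with
  | base => rfl
  | succ q hpq ih =>
    rw [← ih (Nat.le_of_succ_le hq) fun k hk hkq => hi k hk (Nat.lt_succ_of_lt hkq)]
    exact ((h.dualPair_inner hf (Nat.le_of_succ_le hq)).projectStep hf
      (h.project ν q hq)).2.2.2.1 i (hi q hpq (Nat.lt_succ_self q)).symm

/-- Each constraint is processed at most once per iteration, so its dual variable takes only the
values before and after the iteration. -/
theorem zInner_eq_of_le (h : IsProjectForgetRun f S a b out T) (hf : IsBregmanFunction f S)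
    {ν k q : ℕ} (hk : k < (T.order ν).length) (hq : q ≤ k) :
    T.zInner ν q ((T.order ν)[k]) = T.z ν ((T.order ν)[k]) := by
  refine h.zInner_eq hf (Nat.zero_le q) (by omega) fun l _ hl heq => ?_
  have := (h.order_nodup ν).getElem_inj_iff.mp heq
  omega

theorem zInner_eq_of_lt (h : IsProjectForgetRun f S a b out T) (hf : IsBregmanFunction f S)
    {ν k q : ℕ} (hk : k < (T.order ν).length) (hq : k < q) (hq' : q ≤ (T.order ν).length) :
    T.zInner ν q ((T.order ν)[k]) = T.z (ν + 1) ((T.order ν)[k]) := by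
  rw [h.next_z]
  refine (h.zInner_eq hf hq' le_rfl fun l hl hl' heq => ?_).symm
  have := (h.order_nodup ν).getElem_inj_iff.mp heq
  omega

theorem zInner_eq_of_notMem (h : IsProjectForgetRun f S a b out T) (hf : IsBregmanFunction f S)
    {ν q : ℕ} {i : ι} (hi : i ∉ T.order ν) (hq : q ≤ (T.order ν).length) :
    T.zInner ν q i = T.z ν i :=
  h.zInner_eq hf (Nat.zero_le q) hq fun _ _ _ heq => hi (heq ▸ List.getElem_mem _)

/-- Forgetting loses nothing: a dual variable changes only at its own projection, and only zeros are
dropped. -/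
theorem mem_active_of_ne_zero (h : IsProjectForgetRun f S a b out T) (hf : IsBregmanFunction f S)
    {ν : ℕ} {i : ι} (hi : T.z ν i ≠ 0) : i ∈ T.active ν := by
  induction ν with
  | zero => simp [h.init_z] at hi
  | succ ν ih =>
    rw [h.forget, Finset.mem_filter]
    refine ⟨?_, hi⟩
    rw [← h.order_toFinset, List.mem_toFinset]
    by_contra hmem
    rw [h.next_z, h.zInner_eq_of_notMem hf hmem le_rfl] at hi
    exact hmem (h.mem_order_iff.mpr (Or.inl (ih hi)))

theorem z_eq_zero_of_notMem_order (h : IsProjectForgetRun f S a b out T)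
    (hf : IsBregmanFunction f S) {ν : ℕ} {i : ι} (hi : i ∉ T.order ν) : T.z ν i = 0 := by
  by_contra hz
  exact hi (h.mem_order_iff.mpr (Or.inl (h.mem_active_of_ne_zero hf hz)))

/-- The effect of the projection in position `k` of iteration `ν`. -/
theorem projectStep (h : IsProjectForgetRun f S a b out T) (hf : IsBregmanFunction f S)
    {ν k : ℕ} (hk : k < (T.order ν).length) :
    ⟪a ((T.order ν)[k]), T.xInner ν (k + 1)⟫ ≤ b ((T.order ν)[k]) ∧
    (T.z (ν + 1) ((T.order ν)[k]) = 0 ∨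
      ⟪a ((T.order ν)[k]), T.xInner ν (k + 1)⟫ = b ((T.order ν)[k])) ∧
    gradient f (T.xInner ν (k + 1)) - gradient f (T.xInner ν k) =
      (T.z ν ((T.order ν)[k]) - T.z (ν + 1) ((T.order ν)[k])) • a ((T.order ν)[k]) ∧
    bregmanDist f (T.xInner ν (k + 1)) (T.xInner ν k) ≤
      lagrangian f a b (T.xInner ν (k + 1)) (T.zInner ν (k + 1)) -
        lagrangian f a b (T.xInner ν k) (T.zInner ν k) := by
  obtain ⟨-, h1, h2, -, h3, h4⟩ :=
    (h.dualPair_inner hf hk.le).projectStep hf (h.project ν k hk)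
  rw [h.zInner_eq_of_le hf hk le_rfl, h.zInner_eq_of_lt hf hk (Nat.lt_succ_self k) hk] at *
  exact ⟨h1, h2, h3, h4⟩

theorem bregmanDist_succ_nonneg (h : IsProjectForgetRun f S a b out T)
    (hf : IsBregmanFunction f S) {ν k : ℕ} (hk : k < (T.order ν).length) :
    0 ≤ bregmanDist f (T.xInner ν (k + 1)) (T.xInner ν k) :=
  hf.bregmanDist_nonneg (subset_closure (h.dualPair_inner hf hk).mem)
    (subset_closure (h.dualPair_inner hf hk.le).mem)
    (hf.differentiableAt _ (h.dualPair_inner hf hk.le).mem)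

theorem lagrangian_inner_le (h : IsProjectForgetRun f S a b out T) (hf : IsBregmanFunction f S)
    {ν p q : ℕ} (hpq : p ≤ q) (hq : q ≤ (T.order ν).length) :
    lagrangian f a b (T.xInner ν p) (T.zInner ν p) ≤
      lagrangian f a b (T.xInner ν q) (T.zInner ν q) := by
  induction q, hpq using Nat.le_induction with
  | base => rfl
  | succ q hpq ih =>
    refine (ih (Nat.le_of_succ_le hq)).trans ?_
    have := (h.projectStep hf hq).2.2.2
    have := h.bregmanDist_succ_nonneg hf hq
    linarith

theorem lagrangian_inner_le_succ (h : IsProjectForgetRun f S a b out T)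
    (hf : IsBregmanFunction f S) {ν k : ℕ} (hk : k ≤ (T.order ν).length) :
    lagrangian f a b (T.xInner ν k) (T.zInner ν k) ≤
      lagrangian f a b (T.x (ν + 1)) (T.z (ν + 1)) := by
  rw [h.next_x, h.next_z]
  exact h.lagrangian_inner_le hf hk le_rfl

theorem lagrangian_le_inner (h : IsProjectForgetRun f S a b out T)
    (hf : IsBregmanFunction f S) {ν k : ℕ} (hk : k ≤ (T.order ν).length) :
    lagrangian f a b (T.x ν) (T.z ν) ≤
      lagrangian f a b (T.xInner ν k) (T.zInner ν k) :=
  h.lagrangian_inner_le hf (Nat.zero_le k) hk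

theorem bregmanDist_succ_le (h : IsProjectForgetRun f S a b out T)
    (hf : IsBregmanFunction f S) {ν k : ℕ} (hk : k < (T.order ν).length) :
    bregmanDist f (T.xInner ν (k + 1)) (T.xInner ν k) ≤
      lagrangian f a b (T.x (ν + 1)) (T.z (ν + 1)) - lagrangian f a b (T.x ν) (T.z ν) := by
  have h1 := (h.projectStep hf hk).2.2.2
  have h2 := h.lagrangian_inner_le_succ hf (Nat.succ_le_of_lt hk)
  have h3 := h.lagrangian_le_inner hf hk.le
  linarith

theorem monotone_lagrangian (h : IsProjectForgetRun f S a b out T)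
    (hf : IsBregmanFunction f S) :
    Monotone fun ν => lagrangian f a b (T.x ν) (T.z ν) :=
  monotone_nat_of_le_succ fun ν => h.lagrangian_inner_le_succ (ν := ν) hf (Nat.zero_le _)

variable {w : EuclideanSpace ℝ (Fin d)}

theorem bregmanDist_feasible_inner_le (h : IsProjectForgetRun f S a b out T)
    (hf : IsBregmanFunction f S) (hw : w ∈ feasibleRegion a b)
    {ν k : ℕ} (hk : k ≤ (T.order ν).length) :
    bregmanDist f w (T.xInner ν k) ≤ f w - lagrangian f a b (T.x ν) (T.z ν) :=
  ((h.dualPair_inner hf hk).bregmanDist_le hw).trans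
    (sub_le_sub_left (h.lagrangian_le_inner hf hk) _)

theorem lagrangian_le (h : IsProjectForgetRun f S a b out T) (hf : IsBregmanFunction f S)
    (hw : w ∈ feasibleRegion a b ∩ closure S) (ν : ℕ) :
    lagrangian f a b (T.x ν) (T.z ν) ≤ f w := by
  have h1 := (h.dualPair hf ν).bregmanDist_le hw.1
  have h2 := hf.bregmanDist_nonneg hw.2 (subset_closure (h.dualPair hf ν).mem)
    (hf.differentiableAt _ (h.dualPair hf ν).mem)
  linarith

/-- All iterates stay in a bounded set. -/
theorem exists_isBounded (h : IsProjectForgetRun f S a b out T) (hf : IsBregmanFunction f S)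
    (hw : w ∈ feasibleRegion a b ∩ closure S) :
    ∃ B : Set (EuclideanSpace ℝ (Fin d)), Bornology.IsBounded B ∧
      ∀ ν, ∀ k ≤ (T.order ν).length, T.xInner ν k ∈ B := by
  refine ⟨_, hf.bounded_right w hw.2 (f w - lagrangian f a b (T.x 0) (T.z 0)), fun ν k hk =>
    ⟨(h.dualPair_inner hf hk).mem, (h.bregmanDist_feasible_inner_le hf hw.1 hk).trans ?_⟩⟩
  exact sub_le_sub_left (h.monotone_lagrangian hf (Nat.zero_le ν)) _

/-- Ultrafilters replace the extraction of convergent subsequences. The limit may leave `S`. -/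
theorem exists_tendsto_ultrafilter (h : IsProjectForgetRun f S a b out T)
    (hf : IsBregmanFunction f S) (hw : w ∈ feasibleRegion a b ∩ closure S) (U : Ultrafilter ℕ) :
    ∃ y ∈ closure S, Tendsto T.x U (𝓝 y) := by
  obtain ⟨B, hB, hTB⟩ := h.exists_isBounded hf hw
  have hmem : ∀ᶠ ν in (U : Filter ℕ), T.x ν ∈ closure B :=
    Eventually.of_forall fun ν => subset_closure (hTB ν 0 (Nat.zero_le _))
  obtain ⟨y, -, hy⟩ := hB.isCompact_closure.ultrafilter_le_nhds (U.map T.x)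
    (by rw [le_principal_iff]; exact hmem)
  exact ⟨y, mem_closure_of_tendsto hy (Eventually.of_forall fun ν => (h.dualPair hf ν).mem), hy⟩

theorem exists_tendsto_lagrangian (h : IsProjectForgetRun f S a b out T)
    (hf : IsBregmanFunction f S) (hw : w ∈ feasibleRegion a b ∩ closure S) :
    ∃ g, Tendsto (fun ν => lagrangian f a b (T.x ν) (T.z ν)) atTop (𝓝 g) :=
  ⟨_, tendsto_atTop_ciSup (h.monotone_lagrangian hf)
    ⟨f w, by rintro _ ⟨ν, rfl⟩; exact h.lagrangian_le hf hw ν⟩⟩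

theorem tendsto_lagrangian_succ_sub (h : IsProjectForgetRun f S a b out T)
    (hf : IsBregmanFunction f S) (hw : w ∈ feasibleRegion a b ∩ closure S) :
    Tendsto (fun ν => lagrangian f a b (T.x (ν + 1)) (T.z (ν + 1)) -
      lagrangian f a b (T.x ν) (T.z ν)) atTop (𝓝 0) := by
  obtain ⟨g, hg⟩ := h.exists_tendsto_lagrangian hf hw
  simpa using ((tendsto_add_atTop_iff_nat 1).mpr hg).sub hg

/-- Along a filter along which the iterates converge, the iterates within the iterations converge to
the same point, uniformly over the position. -/
theorem eventually_dist_inner_lt (h : IsProjectForgetRun f S a b out T)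
    (hf : IsBregmanFunction f S) (hw : w ∈ feasibleRegion a b ∩ closure S) {l : Filter ℕ}
    (hl : l ≤ atTop) {y : EuclideanSpace ℝ (Fin d)} (hy : Tendsto T.x l (𝓝 y)) {ε : ℝ}
    (hε : 0 < ε) :
    ∀ᶠ ν in l, ∀ k ≤ (T.order ν).length, dist (T.xInner ν k) y < ε := by
  obtain ⟨B, hB, hTB⟩ := h.exists_isBounded hf hw
  -- The number of projections varies with `ν`; clamping the position freezes the point after the
  -- last one. Each step is controlled by the gain of the whole iteration, which tends to 0.
  have key : ∀ k, Tendsto (fun ν => T.xInner ν (min k (T.order ν).length)) l (𝓝 y) := by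
    intro k
    induction k with
    | zero => 
      simp only [Nat.zero_min]
      exact hy
    | succ k ih =>
      refine hf.tendsto_of_tendsto_bregmanDist hB
        (Eventually.of_forall fun ν => (h.dualPair_inner hf (min_le_right _ _)).mem)
        (Eventually.of_forall fun ν =>
          subset_closure (h.dualPair_inner hf (min_le_right _ _)).mem)
        (Eventually.of_forall fun ν => hTB ν _ (min_le_right _ _)) ?_ ih
      refine squeeze_zero (fun ν => ?_) (fun ν => ?_)
        ((h.tendsto_lagrangian_succ_sub hf hw).mono_left hl)
      · rcases lt_or_ge k (T.order ν).length with hk | hk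
        · rw [min_eq_left hk, min_eq_left hk.le]
          exact h.bregmanDist_succ_nonneg hf hk
        · rw [min_eq_right hk, min_eq_right (hk.trans (Nat.le_succ k)), bregmanDist_self]
      · rcases lt_or_ge k (T.order ν).length with hk | hk
        · rw [min_eq_left hk, min_eq_left hk.le]
          exact h.bregmanDist_succ_le hf hk
        · rw [min_eq_right hk, min_eq_right (hk.trans (Nat.le_succ k)), bregmanDist_self]
          exact sub_nonneg.mpr (h.monotone_lagrangian hf (Nat.le_succ ν))
  -- Uniformity is free: at most `Fintype.card ι + 1` positions occur.
  have hall : ∀ᶠ ν in l, ∀ k ∈ Finset.range (Fintype.card ι + 1),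
      dist (T.xInner ν (min k (T.order ν).length)) y < ε :=
    (Finset.eventually_all _).mpr fun k _ => Metric.tendsto_nhds.mp (key k) ε hε
  filter_upwards [hall] with ν hν k hk
  have := hν k (Finset.mem_range.mpr (Nat.lt_succ_of_le (hk.trans (h.length_le ν))))
  rwa [min_eq_left hk] at this

/-- A constraint returned by the oracle is asymptotically satisfied. -/
theorem eventually_inner_lt_of_mem_out (h : IsProjectForgetRun f S a b out T)
    (hf : IsBregmanFunction f S) (hw : w ∈ feasibleRegion a b ∩ closure S) (i : ι) {ε : ℝ}
    (hε : 0 < ε) : ∀ᶠ ν in atTop, i ∈ out ν → ⟪a i, T.x ν⟫ < b i + ε := by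
  -- Along an ultrafilter of violating iterations the limit violates `i`, hence so do all nearby
  -- inner iterates, including the one just after the projection onto `i`.
  by_contra hcon
  rw [not_eventually, frequently_iff_neBot] at hcon
  set l := atTop ⊓ 𝓟 {ν | ¬(i ∈ out ν → ⟪a i, T.x ν⟫ < b i + ε)} with hl
  let U := Ultrafilter.of l
  have hU : (U : Filter ℕ) ≤ l := Ultrafilter.of_le l
  obtain ⟨y, -, hy⟩ := h.exists_tendsto_ultrafilter hf hw U
  have hbad : ∀ᶠ ν in (U : Filter ℕ), i ∈ out ν ∧ b i + ε ≤ ⟪a i, T.x ν⟫ := by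
    have : ∀ᶠ ν in (U : Filter ℕ), ¬(i ∈ out ν → ⟪a i, T.x ν⟫ < b i + ε) :=
      hU (mem_inf_of_right (mem_principal_self _))
    filter_upwards [this] with ν hν
    push Not at hν
    exact hν
  have hge : b i + ε ≤ ⟪a i, y⟫ :=
    ge_of_tendsto (tendsto_const_nhds.inner hy) (hbad.mono fun ν hν => hν.2)
  have hlt : ∀ᶠ v in 𝓝 y, b i < ⟪a i, v⟫ :=
    (tendsto_const_nhds.inner tendsto_id).eventually (lt_mem_nhds (by linarith))
  obtain ⟨δ, hδ, hball⟩ := Metric.eventually_nhds_iff.mp hlt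
  obtain ⟨ν, hν, hν'⟩ :=
    (hbad.and (h.eventually_dist_inner_lt hf hw (hU.trans inf_le_left) hy hδ)).exists
  obtain ⟨k, hk, rfl⟩ := List.getElem_of_mem (h.mem_order_iff.mpr (Or.inr hν.1))
  exact absurd (h.projectStep hf hk).1 (not_le.mpr (hball (hν' (k + 1) hk)))

/-- A constraint that is strictly satisfied during an iteration has no dual variable after it. -/
theorem z_succ_eq_zero (h : IsProjectForgetRun f S a b out T) (hf : IsBregmanFunction f S)
    {ν : ℕ} {i : ι} (hi : ∀ k ≤ (T.order ν).length, ⟪a i, T.xInner ν k⟫ < b i) :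
    T.z (ν + 1) i = 0 := by
  by_cases hmem : i ∈ T.order ν
  · obtain ⟨k, hk, rfl⟩ := List.getElem_of_mem hmem
    exact (h.projectStep hf hk).2.1.resolve_right (hi (k + 1) hk).ne
  · rw [h.next_z, h.zInner_eq_of_notMem hf hmem le_rfl, h.z_eq_zero_of_notMem_order hf hmem]

/-- The Lagrangian tends to the optimal value as soon as the constraints are asymptotically
satisfied. -/
theorem tendsto_lagrangian (h : IsProjectForgetRun f S a b out T)
    (hf : IsBregmanFunction f S) (hopt : IsOptimalSolution f S a b w)
    (hfeas : ∀ i, ∀ ε > 0, ∀ᶠ ν in atTop, ⟪a i, T.x ν⟫ < b i + ε) :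
    Tendsto (fun ν => lagrangian f a b (T.x ν) (T.z ν)) atTop (𝓝 (f w)) := by
  obtain ⟨g, hg⟩ := h.exists_tendsto_lagrangian hf hopt.1
  suffices hgw : g = f w from hgw ▸ hg
  refine le_antisymm (le_of_tendsto' hg fun ν => h.lagrangian_le hf hopt.1 ν) ?_
  let U := Ultrafilter.of (atTop : Filter ℕ)
  have hU : (U : Filter ℕ) ≤ atTop := Ultrafilter.of_le _
  obtain ⟨y, hyS, hy⟩ := h.exists_tendsto_ultrafilter hf hopt.1 U
  have hyC : y ∈ feasibleRegion a b := by
    refine mem_feasibleRegion_iff.mpr fun i => le_of_forall_pos_le_add fun ε hε => ?_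
    exact le_of_tendsto (tendsto_const_nhds.inner hy)
      (((hfeas i ε hε).filter_mono hU).mono fun ν hν => hν.le)
  -- Complementary slackness at the limit point `y`. It holds for index `ν + 1` because slackness
  -- throughout iteration `ν` is what clears the variable.
  have hz : ∀ᶠ ν in (U : Filter ℕ), ∀ i, T.z (ν + 1) i * (b i - ⟪a i, y⟫) = 0 := by
    refine eventually_all.mpr fun i => ?_
    rcases (mem_feasibleRegion_iff.mp hyC i).eq_or_lt with heq | hlt
    · exact Eventually.of_forall fun ν => by rw [heq, sub_self, mul_zero]
    · have hlt' : ∀ᶠ v in 𝓝 y, ⟪a i, v⟫ < b i :=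
        (tendsto_const_nhds.inner tendsto_id).eventually (gt_mem_nhds hlt)
      obtain ⟨δ, hδ, hball⟩ := Metric.eventually_nhds_iff.mp hlt'
      filter_upwards [h.eventually_dist_inner_lt hf hopt.1 hU hy hδ] with ν hν
      rw [h.z_succ_eq_zero hf fun k hk => hball (hν k hk), zero_mul]
  have hlim : Tendsto (fun ν => T.x (ν + 1)) U (𝓝 y) := by
    refine Metric.tendsto_nhds.mpr fun ε hε => ?_
    filter_upwards [h.eventually_dist_inner_lt hf hopt.1 hU hy hε] with ν hν
    rw [h.next_x]
    exact hν _ le_rfl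
  have hD := hf.tendsto_bregmanDist (Eventually.of_forall fun ν => (h.dualPair hf (ν + 1)).mem)
    hlim
  have hg' : Tendsto (fun ν => f y - lagrangian f a b (T.x (ν + 1)) (T.z (ν + 1))) U
      (𝓝 (f y - g)) :=
    tendsto_const_nhds.sub (((tendsto_add_atTop_iff_nat 1).mpr hg).mono_left hU)
  -- Slackness reduces f(y) minus the Lagrangian to D_f(y, x), which tends to 0.
  have heq : f y - g = 0 := by
    refine tendsto_nhds_unique hg' (hD.congr' ?_)
    filter_upwards [hz] with ν hν
    rw [(h.dualPair hf (ν + 1)).sub_lagrangian y, Finset.sum_eq_zero fun i _ => hν i, add_zero]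
  have := isMinOn_iff.mp hopt.2 y ⟨hyC, hyS⟩
  linarith

/-- Convergence of the primal variables, uniformly over the position within an iteration. -/
theorem eventually_dist_inner_optimal_lt (h : IsProjectForgetRun f S a b out T)
    (hf : IsBregmanFunction f S) (hopt : IsOptimalSolution f S a b w)
    (hfeas : ∀ i, ∀ ε > 0, ∀ᶠ ν in atTop, ⟪a i, T.x ν⟫ < b i + ε) {ε : ℝ} (hε : 0 < ε) :
    ∀ᶠ ν in atTop, ∀ k ≤ (T.order ν).length, dist (T.xInner ν k) w < ε := by
  refine h.eventually_dist_inner_lt hf hopt.1 le_rfl ?_ hε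
  have hgap : Tendsto (fun ν => f w - lagrangian f a b (T.x ν) (T.z ν)) atTop (𝓝 0) := by
    simpa using (h.tendsto_lagrangian hf hopt hfeas).const_sub (f w)
  have hD : Tendsto (fun ν => bregmanDist f w (T.x ν)) atTop (𝓝 0) :=
    squeeze_zero (fun ν => hf.bregmanDist_nonneg hopt.1.2
      (subset_closure (h.dualPair hf ν).mem) (hf.differentiableAt _ (h.dualPair hf ν).mem))
      (fun ν => (h.dualPair hf ν).bregmanDist_le hopt.1.1) hgap
  -- With limit `y` of the iterates, the last Bregman axiom applied to the constant sequence `w`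
  -- forces `w = y`.
  refine (tendsto_iff_ultrafilter _ _ _).mpr fun U hU => ?_
  obtain ⟨y, -, hy⟩ := h.exists_tendsto_ultrafilter hf hopt.1 U
  have hc : Tendsto (fun _ => w) (U : Filter ℕ) (𝓝 y) :=
    hf.tendsto_of_tendsto_bregmanDist (Bornology.isBounded_singleton (x := w))
      (Eventually.of_forall fun ν => (h.dualPair hf ν).mem)
      (Eventually.of_forall fun _ => hopt.1.2) (Eventually.of_forall fun _ => rfl)
      (hD.mono_left hU) hy
  rwa [tendsto_nhds_unique tendsto_const_nhds hc]

end IsProjectForgetRun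

end Run

/-! ### Quadratic estimates near the solution -/

section LocalEstimates

variable {d : ℕ} {f : EuclideanSpace ℝ (Fin d) → ℝ} {S : Set (EuclideanSpace ℝ (Fin d))}
  {w : EuclideanSpace ℝ (Fin d)}

theorem exists_pos_mul_sq_norm_le_inner
    (A : EuclideanSpace ℝ (Fin d) →L[ℝ] EuclideanSpace ℝ (Fin d))
    (hA : ∀ v : EuclideanSpace ℝ (Fin d), v ≠ 0 → 0 < ⟪v, A v⟫) :
    ∃ m > 0, ∀ v, m * ‖v‖ ^ 2 ≤ ⟪v, A v⟫ := by
  -- The sphere is empty when `d = 0`.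
  rcases (Metric.sphere (0 : EuclideanSpace ℝ (Fin d)) 1).eq_empty_or_nonempty with he | hne
  · refine ⟨1, one_pos, fun v => ?_⟩
    have hv : v = 0 := by
      by_contra hv
      have : (‖v‖⁻¹ • v) ∈ Metric.sphere (0 : EuclideanSpace ℝ (Fin d)) 1 := by
        simp [norm_smul, hv]
      rw [he] at this
      exact this
    simp [hv]
  · obtain ⟨v₀, hv₀, hmin⟩ := (isCompact_sphere (0 : EuclideanSpace ℝ (Fin d)) 1).exists_isMinOn
      hne (f := fun v => ⟪v, A v⟫) (by fun_prop)
    have hv₀' : ‖v₀‖ = 1 := by simpa using hv₀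
    refine ⟨⟪v₀, A v₀⟫, hA v₀ (by rintro rfl; simp at hv₀'), fun v => ?_⟩
    rcases eq_or_ne v 0 with rfl | hv
    · simp
    have hn : ‖v‖ ≠ 0 := norm_ne_zero_iff.mpr hv
    have h1 := isMinOn_iff.mp hmin (‖v‖⁻¹ • v) (by simp [norm_smul, hv])
    simp only [map_smul, inner_smul_left, inner_smul_right, RCLike.conj_to_real] at h1
    calc ⟪v₀, A v₀⟫ * ‖v‖ ^ 2 ≤ (‖v‖⁻¹ * (‖v‖⁻¹ * ⟪v, A v⟫)) * ‖v‖ ^ 2 := by gcongr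
      _ = ⟪v, A v⟫ := by field_simp

theorem TwiceDifferentiableAt.eventually_gradient (hw : TwiceDifferentiableAt f w) {η : ℝ}
    (hη : 0 < η) : ∀ᶠ x in 𝓝 w, DifferentiableAt ℝ f x ∧
      ‖gradient f x - gradient f w - hessian f w (x - w)‖ ≤ η * ‖x - w‖ :=
  hw.1.and (hw.2.hasFDerivAt.isLittleO.def hη)

/-- Two-sided quadratic bounds for the Bregman distance near a point at which the Hessian exists and
is positive definite. Between two points the lower bound holds up to an error that is small compared
with their squared distances to the base point. -/
theorem IsBregmanFunction.exists_local_bounds (hf : IsBregmanFunction f S) (hwS : w ∈ closure S)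
    (hw : TwiceDifferentiableAt f w)
    (hpos : ∀ v : EuclideanSpace ℝ (Fin d), v ≠ 0 → 0 < ⟪v, hessian f w v⟫) :
    ∃ m > 0, ∃ K > 0, ∀ η > 0, ∃ ρ > 0, ∀ x ∈ S, dist x w < ρ →
      ‖gradient f x - gradient f w‖ ≤ K * ‖x - w‖ ∧
      bregmanDist f w x ≤ K * ‖x - w‖ ^ 2 ∧
      m * ‖x - w‖ ^ 2 ≤ bregmanDist f w x ∧
      ∀ x' ∈ S, dist x' w < ρ →
        m * ‖x' - x‖ ^ 2 ≤ bregmanDist f x' x + η * (‖x - w‖ ^ 2 + ‖x' - w‖ ^ 2) ∧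
        ‖gradient f x' - gradient f x‖ ≤ K * ‖x' - x‖ + η * (‖x - w‖ + ‖x' - w‖) := by
  obtain ⟨m, hm, hmH⟩ := exists_pos_mul_sq_norm_le_inner (hessian f w) hpos
  have hK : 0 < ‖hessian f w‖ + 1 := by positivity
  refine ⟨m / 8, by positivity, ‖hessian f w‖ + 1, hK, fun η hη => ?_⟩
  -- The bound 1 gives `K`, `η / 2` absorbs the factor 2 in `hlow`, and `m / 16` turns `m / 4` into
  -- `m / 8` when `x' = w`.
  set η' := min 1 (min (η / 2) (m / 16)) with hη'
  have hη'0 : 0 < η' := by positivity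
  have hη1 : η' ≤ 1 := min_le_left _ _
  have hη2 : η' ≤ η / 2 := (min_le_right _ _).trans (min_le_left _ _)
  have hη3 : η' ≤ m / 16 := (min_le_right _ _).trans (min_le_right _ _)
  obtain ⟨ρ, hρ, hball⟩ := Metric.eventually_nhds_iff.mp (hw.eventually_gradient hη'0)
  have hgrad : ∀ x y, dist x w < ρ → dist y w < ρ →
      ‖gradient f x - gradient f y - hessian f w (x - y)‖ ≤ η' * (‖x - w‖ + ‖y - w‖) := by
    intro x y hx hy
    have : gradient f x - gradient f y - hessian f w (x - y) =
        (gradient f x - gradient f w - hessian f w (x - w)) -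
          (gradient f y - gradient f w - hessian f w (y - w)) := by
      simp only [map_sub]; abel
    rw [this, mul_add]
    exact (norm_sub_le _ _).trans (add_le_add (hball hx).2 (hball hy).2)
  have hlow : ∀ x ∈ S, dist x w < ρ → ∀ x' ∈ closure S, dist x' w < ρ →
      m / 4 * ‖x' - x‖ ^ 2 ≤ bregmanDist f x' x + 2 * η' * (‖x - w‖ ^ 2 + ‖x' - w‖ ^ 2) := by
    intro x hx hxρ x' hx' hxρ'
    -- The second derivative exists only at `w`, so no Taylor formula along the segment is at hand.
    -- Splitting D_f(x', x) at the midpoint and dropping two nonnegative distances leaves a gradient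
    -- difference, which the expansion at `w` controls.
    set y : EuclideanSpace ℝ (Fin d) := (1 / 2 : ℝ) • x + (1 / 2 : ℝ) • x' with hy
    have hyS : y ∈ closure S := hf.convex.closure (subset_closure hx) hx' (by norm_num)
      (by norm_num) (by norm_num)
    have hyρ : dist y w < ρ :=
      convex_ball w ρ hxρ hxρ' (by norm_num) (by norm_num) (by norm_num)
    have h1 := hf.bregmanDist_nonneg hx' hyS (hball hyρ).1
    have h2 := hf.bregmanDist_nonneg hyS (subset_closure hx) (hf.differentiableAt x hx)
    have h3 := bregmanDist_eq_add (f := f) x' y x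
    set v : EuclideanSpace ℝ (Fin d) := (1 / 2 : ℝ) • (x' - x) with hv
    have hv1 : x' - y = v := by rw [hy, hv]; module
    have hv2 : y - x = v := by rw [hy, hv]; module
    have hnv : ‖v‖ = 1 / 2 * ‖x' - x‖ := by rw [hv, norm_smul]; norm_num
    have hnx : ‖x' - x‖ ≤ ‖x - w‖ + ‖x' - w‖ := by
      have : x' - x = (x' - w) - (x - w) := by abel
      rw [this, add_comm]; exact norm_sub_le _ _
    have hny : ‖y - w‖ ≤ 1 / 2 * (‖x - w‖ + ‖x' - w‖) := by
      have : y - w = (1 / 2 : ℝ) • (x - w) + (1 / 2 : ℝ) • (x' - w) := by rw [hy]; module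
      rw [this]
      refine (norm_add_le _ _).trans (le_of_eq ?_)
      rw [norm_smul, norm_smul]; norm_num; ring
    have h4 := hgrad y x hyρ hxρ
    have h5 := (abs_le.mp (abs_real_inner_le_norm v
      (gradient f y - gradient f x - hessian f w (y - x)))).1
    rw [inner_sub_right, hv2] at h5
    rw [hv2] at h4
    have h6 := hmH v
    rw [hv1, real_inner_comm] at h3
    have h7 : ‖v‖ * ‖gradient f y - gradient f x - hessian f w v‖ ≤
        2 * η' * (‖x - w‖ ^ 2 + ‖x' - w‖ ^ 2) := by
      have hp := norm_nonneg (x - w)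
      have hq := norm_nonneg (x' - w)
      calc ‖v‖ * ‖gradient f y - gradient f x - hessian f w v‖
          ≤ (1 / 2 * (‖x - w‖ + ‖x' - w‖)) *
            (η' * (1 / 2 * (‖x - w‖ + ‖x' - w‖) + ‖x - w‖)) := by
            rw [hnv]; gcongr; exact h4.trans (by gcongr)
        _ = η' * ((1 / 2 * (‖x - w‖ + ‖x' - w‖)) *
            (1 / 2 * (‖x - w‖ + ‖x' - w‖) + ‖x - w‖)) := by ring
        _ ≤ η' * (2 * (‖x - w‖ ^ 2 + ‖x' - w‖ ^ 2)) := by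
            refine mul_le_mul_of_nonneg_left ?_ hη'0.le
            nlinarith [sq_nonneg (‖x - w‖ - ‖x' - w‖)]
        _ = _ := by ring
    have h8 : m * ‖v‖ ^ 2 = m / 4 * ‖x' - x‖ ^ 2 := by rw [hnv]; ring
    linarith
  have hwρ : dist w w < ρ := by simpa using hρ
  refine ⟨ρ, hρ, fun x hx hxρ => ?_⟩
  have hg : ∀ y, dist y w < ρ → ‖gradient f x - gradient f y‖ ≤
      ‖hessian f w‖ * ‖x - y‖ + η' * (‖x - w‖ + ‖y - w‖) := by
    intro y hy
    have h1 := hgrad x y hxρ hy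
    have h2 := norm_le_norm_add_norm_sub' (gradient f x - gradient f y) (hessian f w (x - y))
    have h3 := (hessian f w).le_opNorm (x - y)
    linarith
  have hg1 : ‖gradient f x - gradient f w‖ ≤ (‖hessian f w‖ + 1) * ‖x - w‖ := by
    have h1 := hg w hwρ
    rw [sub_self, norm_zero, add_zero] at h1
    nlinarith [norm_nonneg (x - w)]
  refine ⟨hg1, ?_, ?_, fun x' hx' hxρ' => ⟨?_, ?_⟩⟩
  -- Adding D_f(x, w) ≥ 0 bounds the distance by an inner product of gradient and point differences.
  · have h1 := bregmanDist_add_bregmanDist_symm (f := f) x w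
    have h2 := hf.bregmanDist_nonneg (subset_closure hx) hwS (hball hwρ).1
    have h3 := real_inner_le_norm (gradient f x - gradient f w) (x - w)
    have h4 := mul_le_mul_of_nonneg_right hg1 (norm_nonneg (x - w))
    rw [pow_two, ← mul_assoc]
    linarith
  · have h1 := hlow x hx hxρ w hwS hwρ
    rw [sub_self, norm_zero, norm_sub_rev w x] at h1
    nlinarith [sq_nonneg ‖x - w‖]
  · have h1 := hlow x hx hxρ x' (subset_closure hx') hxρ'
    nlinarith [sq_nonneg ‖x - w‖, sq_nonneg ‖x' - w‖, sq_nonneg ‖x' - x‖]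
  · have h1 := hg x' hxρ'
    rw [norm_sub_rev, norm_sub_rev x x'] at h1
    nlinarith [norm_nonneg (x - w), norm_nonneg (x' - w), norm_nonneg (x' - x)]

end LocalEstimates

/-! ### Consequences of a stalling duality gap -/

section Rate

variable {d : ℕ} {ι : Type*} [Fintype ι] [DecidableEq ι] {f : EuclideanSpace ℝ (Fin d) → ℝ}
  {S : Set (EuclideanSpace ℝ (Fin d))} {a : ι → EuclideanSpace ℝ (Fin d)} {b : ι → ℝ}
  {out : ℕ → Finset ι} {T : Trace d ι} {w : EuclideanSpace ℝ (Fin d)}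

/-- If no rate `1 - δ` holds eventually, then all of them fail along some ultrafilter. -/
theorem exists_ultrafilter_of_not_linear_rate {g : ℕ → ℝ} (hg : ∀ ν, 0 ≤ g ν)
    (h : ¬∃ δ > 0, ∀ᶠ ν in atTop, g (ν + 1) ≤ (1 - δ) * g ν) :
    ∃ U : Ultrafilter ℕ, (U : Filter ℕ) ≤ atTop ∧
      ∀ δ > 0, ∀ᶠ ν in (U : Filter ℕ), (1 - δ) * g ν < g (ν + 1) := by
  have h1 : ∀ n : ℕ, ∃ᶠ ν in atTop, (1 - 1 / ((n : ℝ) + 1)) * g ν < g (ν + 1) := by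
    intro n hn
    refine h ⟨1 / ((n : ℝ) + 1), by positivity, ?_⟩
    filter_upwards [hn] with ν hν using not_lt.mp hν
  -- At index `φ n` the rate `1 - 1 / (n + 1)` fails; pushing an ultrafilter forward along `φ` makes
  -- every rate fail eventually.
  obtain ⟨φ, hφ, hφ'⟩ := extraction_forall_of_frequently h1
  refine ⟨(Ultrafilter.of atTop).map φ,
    (map_mono (Ultrafilter.of_le _)).trans hφ.tendsto_atTop, fun δ hδ => ?_⟩
  refine Ultrafilter.of_le (atTop : Filter ℕ) ?_
  filter_upwards [tendsto_one_div_add_atTop_nhds_zero_nat.eventually (gt_mem_nhds hδ)] with n hn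
  have h2 := hφ' n
  have h3 := hg (φ n)
  show (1 - δ) * g (φ n) < g (φ n + 1)
  nlinarith

namespace IsProjectForgetRun

/-- The dual variables of the constraints that are not tight at the solution eventually vanish. -/
theorem eventually_z_eq_zero (h : IsProjectForgetRun f S a b out T)
    (hf : IsBregmanFunction f S) (hopt : IsOptimalSolution f S a b w)
    (hfeas : ∀ i, ∀ ε > 0, ∀ᶠ ν in atTop, ⟪a i, T.x ν⟫ < b i + ε) :
    ∀ᶠ ν in atTop, ∀ i, ⟪a i, w⟫ ≠ b i → T.z ν i = 0 := by
  refine eventually_all.mpr fun i => ?_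
  by_cases hi : ⟪a i, w⟫ = b i
  · exact Eventually.of_forall fun ν hν => absurd hi hν
  have hlt : ∀ᶠ v in 𝓝 w, ⟪a i, v⟫ < b i :=
    (tendsto_const_nhds.inner tendsto_id).eventually
      (gt_mem_nhds ((mem_feasibleRegion_iff.mp hopt.1.1 i).lt_of_ne hi))
  obtain ⟨ε, hε, hball⟩ := Metric.eventually_nhds_iff.mp hlt
  obtain ⟨N, hN⟩ :=
    eventually_atTop.mp (h.eventually_dist_inner_optimal_lt hf hopt hfeas hε)
  refine eventually_atTop.mpr ⟨N + 1, fun ν hν _ => ?_⟩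
  obtain ⟨μ, rfl⟩ := Nat.exists_eq_add_of_le' (Nat.le_of_succ_le hν)
  obtain ⟨μ, rfl⟩ : ∃ μ', μ = μ' + 1 := ⟨μ - 1, by omega⟩
  rw [show μ + 1 + N = μ + N + 1 by omega]
  exact h.z_succ_eq_zero hf fun k hk => hball (hN _ (Nat.le_add_left _ _) k hk)

/-- Complementary slackness at `w` becomes exact, so the gap inherits the two-sided quadratic bounds
of the Bregman distance. -/
theorem eventually_gap_eq (h : IsProjectForgetRun f S a b out T)
    (hf : IsBregmanFunction f S) (hopt : IsOptimalSolution f S a b w)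
    (hfeas : ∀ i, ∀ ε > 0, ∀ᶠ ν in atTop, ⟪a i, T.x ν⟫ < b i + ε) :
    ∀ᶠ ν in atTop, f w - lagrangian f a b (T.x ν) (T.z ν) = bregmanDist f w (T.x ν) := by
  filter_upwards [h.eventually_z_eq_zero hf hopt hfeas] with ν hν
  rw [(h.dualPair hf ν).sub_lagrangian w, Finset.sum_eq_zero, add_zero]
  intro i _
  by_cases hi : ⟪a i, w⟫ = b i
  · rw [hi, sub_self, mul_zero]
  · rw [hν i hi, zero_mul]

/-- If the duality gap hardly decreases, then the steps within an iteration, and the changes of the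
gradient, are small compared with the distance to the solution. -/
theorem eventually_steps_le (h : IsProjectForgetRun f S a b out T)
    (hf : IsBregmanFunction f S) (hopt : IsOptimalSolution f S a b w)
    (hfeas : ∀ i, ∀ ε > 0, ∀ᶠ ν in atTop, ⟪a i, T.x ν⟫ < b i + ε)
    (htwice : TwiceDifferentiableAt f w)
    (hpos : ∀ v : EuclideanSpace ℝ (Fin d), v ≠ 0 → 0 < ⟪v, hessian f w v⟫)
    {l : Filter ℕ} (hl : l ≤ atTop)
    (hrate : ∀ δ > 0, ∀ᶠ ν in l, (1 - δ) * (f w - lagrangian f a b (T.x ν) (T.z ν)) <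
      f w - lagrangian f a b (T.x (ν + 1)) (T.z (ν + 1))) {κ : ℝ} (hκ : 0 < κ) :
    ∀ᶠ ν in l, ∀ k, k < (T.order ν).length →
      ‖T.xInner ν (k + 1) - T.xInner ν k‖ ≤ κ * ‖T.x ν - w‖ ∧
      ‖gradient f (T.xInner ν (k + 1)) - gradient f (T.xInner ν k)‖ ≤ κ * ‖T.x ν - w‖ := by
  obtain ⟨m, hm, K, hK, hloc⟩ := hf.exists_local_bounds hopt.1.2 htwice hpos
  -- Inner iterates stay within `C * r` of `w`, since m‖x - w‖² ≤ D_f(w, x) ≤ gap ≤ K r².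
  set C := Real.sqrt (K / m) with hC
  have hC0 : 0 < C := Real.sqrt_pos.mpr (div_pos hK hm)
  have hC2 : m * C ^ 2 = K := by rw [hC, Real.sq_sqrt (div_pos hK hm).le]; field_simp
  set κ' := min κ (κ / (2 * K)) with hκ'
  have hκ'0 : 0 < κ' := by positivity
  have hκ1 : κ' ≤ κ := min_le_left _ _
  have hκ2 : K * κ' ≤ κ / 2 := by
    calc K * κ' ≤ K * (κ / (2 * K)) := by gcongr; exact min_le_right _ _
      _ = κ / 2 := by field_simp
  -- The gain (through `δ`) and the error (through `η`) each get half of `m * κ' ^ 2 * r ^ 2`; for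
  -- gradients, `κ'` and `η` each take half of `κ`.
  set δ := m * κ' ^ 2 / (2 * K) with hδ
  set η := min (m * κ' ^ 2 / (4 * C ^ 2)) (κ / (4 * C)) with hη
  have hη0 : 0 < η := by positivity
  have hη1 : η * (2 * C ^ 2) ≤ m * κ' ^ 2 / 2 := by
    calc η * (2 * C ^ 2) ≤ m * κ' ^ 2 / (4 * C ^ 2) * (2 * C ^ 2) := by
          gcongr; exact min_le_left _ _
      _ = m * κ' ^ 2 / 2 := by field_simp; norm_num
  have hη2 : η * (2 * C) ≤ κ / 2 := by
    calc η * (2 * C) ≤ κ / (4 * C) * (2 * C) := by gcongr; exact min_le_right _ _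
      _ = κ / 2 := by field_simp; norm_num
  obtain ⟨ρ, hρ, hb⟩ := hloc η hη0
  filter_upwards [(h.eventually_dist_inner_optimal_lt hf hopt hfeas hρ).filter_mono hl,
    (h.eventually_gap_eq hf hopt hfeas).filter_mono hl, hrate δ (by positivity)]
    with ν hν hgap hr k hk
  set r := ‖T.x ν - w‖ with hrdef
  have hr0 : 0 ≤ r := norm_nonneg _
  have hgapK : f w - lagrangian f a b (T.x ν) (T.z ν) ≤ K * r ^ 2 := by
    rw [hgap]; exact (hb _ (h.dualPair hf ν).mem (hν 0 (Nat.zero_le _))).2.1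
  have hdist : ∀ q ≤ (T.order ν).length, ‖T.xInner ν q - w‖ ≤ C * r := by
    intro q hq
    have h1 := (hb _ (h.dualPair_inner hf hq).mem (hν q hq)).2.2.1
    have h2 := h.bregmanDist_feasible_inner_le hf hopt.1.1 hq
    refine le_of_sq_le_sq ?_ (by positivity)
    refine le_of_mul_le_mul_left (a := m) ?_ hm
    calc m * ‖T.xInner ν q - w‖ ^ 2 ≤ K * r ^ 2 := by linarith
      _ = m * (C * r) ^ 2 := by rw [mul_pow, ← mul_assoc, hC2]
  obtain ⟨h1, h2⟩ := (hb _ (h.dualPair_inner hf hk.le).mem (hν k hk.le)).2.2.2 _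
    (h.dualPair_inner hf hk).mem (hν (k + 1) hk)
  have h3 := h.bregmanDist_succ_le hf hk
  have h4 : δ * (f w - lagrangian f a b (T.x ν) (T.z ν)) ≤ m * κ' ^ 2 / 2 * r ^ 2 := by
    calc _ ≤ δ * (K * r ^ 2) := by gcongr
      _ = _ := by rw [hδ]; field_simp
  have h5 : η * (‖T.xInner ν k - w‖ ^ 2 + ‖T.xInner ν (k + 1) - w‖ ^ 2) ≤
      m * κ' ^ 2 / 2 * r ^ 2 := by
    calc _ ≤ η * ((C * r) ^ 2 + (C * r) ^ 2) := by
          gcongr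
          · exact hdist k hk.le
          · exact hdist (k + 1) hk
      _ = η * (2 * C ^ 2) * r ^ 2 := by ring
      _ ≤ _ := by gcongr
  have h6 : ‖T.xInner ν (k + 1) - T.xInner ν k‖ ≤ κ' * r := by
    refine le_of_sq_le_sq ?_ (by positivity)
    refine le_of_mul_le_mul_left (a := m) ?_ hm
    rw [mul_pow]
    linarith
  refine ⟨h6.trans (by gcongr), h2.trans ?_⟩
  calc _ ≤ K * (κ' * r) + η * (C * r + C * r) := by
        gcongr
        · exact hdist k hk.le
        · exact hdist (k + 1) hk
    _ = K * κ' * r + η * (2 * C) * r := by ring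
    _ ≤ κ / 2 * r + κ / 2 * r := by gcongr
    _ = κ * r := by ring

end IsProjectForgetRun

end Rate

theorem Trace.norm_xInner_sub_le {d : ℕ} {ι : Type*} (T : Trace d ι) {ν : ℕ} {c : ℝ} {k : ℕ}
    (hk : k ≤ (T.order ν).length)
    (h : ∀ k, k < (T.order ν).length →
      ‖T.xInner ν (k + 1) - T.xInner ν k‖ ≤ c) :
    ‖T.xInner ν k - T.x ν‖ ≤ k * c := by
  induction k with
  | zero => simp [Trace.x]
  | succ k ih =>
    have h1 := norm_sub_le_norm_sub_add_norm_sub (T.xInner ν (k + 1)) (T.xInner ν k) (T.x ν)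
    have h2 := ih (Nat.le_of_succ_le hk)
    have h3 := h k hk
    push_cast
    linarith

/-! ### Linear decrease of the duality gap -/

section LinearRate

variable {d : ℕ} {ι : Type*} [Fintype ι] [DecidableEq ι] {f : EuclideanSpace ℝ (Fin d) → ℝ}
  {S : Set (EuclideanSpace ℝ (Fin d))} {a : ι → EuclideanSpace ℝ (Fin d)} {b : ι → ℝ}
  {out : ℕ → Finset ι} {T : Trace d ι} {w : EuclideanSpace ℝ (Fin d)}

namespace IsProjectForgetRun

theorem eventually_norm_inner_sub_le (h : IsProjectForgetRun f S a b out T) {l : Filter ℕ}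
    (hsteps : ∀ κ > 0, ∀ᶠ ν in l, ∀ k, k < (T.order ν).length →
      ‖T.xInner ν (k + 1) - T.xInner ν k‖ ≤ κ * ‖T.x ν - w‖) {κ : ℝ} (hκ : 0 < κ) :
    ∀ᶠ ν in l, ∀ k ≤ (T.order ν).length, ‖T.xInner ν k - T.x ν‖ ≤ κ * ‖T.x ν - w‖ := by
  filter_upwards [hsteps (κ / (Fintype.card ι + 1)) (by positivity)] with ν hν k hk
  refine (T.norm_xInner_sub_le hk hν).trans ?_
  have hkc : (k : ℝ) ≤ Fintype.card ι + 1 := by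
    have := hk.trans (h.length_le ν)
    exact_mod_cast this.trans (Nat.le_succ _)
  calc (k : ℝ) * (κ / (Fintype.card ι + 1) * ‖T.x ν - w‖)
      ≤ (Fintype.card ι + 1) * (κ / (Fintype.card ι + 1) * ‖T.x ν - w‖) := by gcongr
    _ = κ * ‖T.x ν - w‖ := by field_simp

/-- Complementarity in the limit: if the steps are small compared with the distance to the solution
and `u` is a limit of the directions from the solution to the iterates, then `z_i ⟪a i, u⟫` is
small compared with the distance, and it is non-positive. -/
theorem tendsto_z_mul_inner_div (h : IsProjectForgetRun f S a b out T)
    (hf : IsBregmanFunction f S) (ha : ∀ i, a i ≠ 0) {U : Ultrafilter ℕ}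
    (hz : ∀ᶠ ν in (U : Filter ℕ), ∀ i, ⟪a i, w⟫ ≠ b i → T.z ν i = 0)
    (hr : ∀ᶠ ν in (U : Filter ℕ), 0 < ‖T.x ν - w‖)
    (hsteps : ∀ κ > 0, ∀ᶠ ν in (U : Filter ℕ), ∀ k, k < (T.order ν).length →
      ‖T.xInner ν (k + 1) - T.xInner ν k‖ ≤ κ * ‖T.x ν - w‖ ∧
      ‖gradient f (T.xInner ν (k + 1)) - gradient f (T.xInner ν k)‖ ≤ κ * ‖T.x ν - w‖)
    {u : EuclideanSpace ℝ (Fin d)}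
    (hu : Tendsto (fun ν => ‖T.x ν - w‖⁻¹ • (T.x ν - w)) U (𝓝 u)) (i : ι) :
    Tendsto (fun ν => T.z ν i * ⟪a i, u⟫ / ‖T.x ν - w‖) U (𝓝 0) ∧
      ∀ᶠ ν in (U : Filter ℕ), T.z ν i * ⟪a i, u⟫ ≤ 0 := by
  have hzero : (∀ᶠ ν in (U : Filter ℕ), T.z ν i = 0) →
      Tendsto (fun ν => T.z ν i * ⟪a i, u⟫ / ‖T.x ν - w‖) U (𝓝 0) ∧
        ∀ᶠ ν in (U : Filter ℕ), T.z ν i * ⟪a i, u⟫ ≤ 0 := by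
    intro h0
    refine ⟨tendsto_const_nhds.congr' ?_, ?_⟩
    · filter_upwards [h0] with ν hν
      rw [hν, zero_mul, zero_div]
    · filter_upwards [h0] with ν hν
      rw [hν, zero_mul]
  by_cases htight : ⟪a i, w⟫ = b i
  swap
  · exact hzero (hz.mono fun ν hν => hν i htight)
  -- An ultrafilter decides whether `i` is processed; if not, its dual variable is 0.
  rcases U.em fun ν => i ∈ T.order ν with hmem | hmem
  swap
  · exact hzero (hmem.mono fun ν hν => h.z_eq_zero_of_notMem_order hf hν)
  have hai : 0 < ‖a i‖ := norm_pos_iff.mpr (ha i)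
  have hnear := fun κ hκ => h.eventually_norm_inner_sub_le (w := w) (l := U) (κ := κ)
    (fun κ hκ => (hsteps κ hκ).mono fun ν hν k hk => (hν k hk).1) hκ
  have hlim : Tendsto (fun ν => ⟪a i, ‖T.x ν - w‖⁻¹ • (T.x ν - w)⟫) U (𝓝 ⟪a i, u⟫) :=
    tendsto_const_nhds.inner hu
  have hcomp : ∀ ν v c, 0 < ‖T.x ν - w‖ → ‖v - T.x ν‖ ≤ c * ‖T.x ν - w‖ →
      |⟪a i, v - w⟫ - ‖T.x ν - w‖ * ⟪a i, ‖T.x ν - w‖⁻¹ • (T.x ν - w)⟫| ≤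
        ‖a i‖ * c * ‖T.x ν - w‖ := by
    intro ν v c hpos hv
    have : ⟪a i, v - w⟫ - ‖T.x ν - w‖ * ⟪a i, ‖T.x ν - w‖⁻¹ • (T.x ν - w)⟫ =
        ⟪a i, v - T.x ν⟫ := by
      rw [inner_smul_right, mul_inv_cancel_left₀ hpos.ne', ← inner_sub_right]
      congr 1; abel
    rw [this, mul_assoc]
    exact (abs_real_inner_le_norm _ _).trans (by gcongr)
  -- After its projection `i` is satisfied at a point w + r(u + o(1)), and it is tight at `w`.
  have hnonpos : ⟪a i, u⟫ ≤ 0 := by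
    refine le_of_forall_pos_le_add fun ε hε => ?_
    rw [zero_add]
    refine le_of_tendsto hlim ?_
    filter_upwards [hmem, hr, hnear (ε / ‖a i‖) (by positivity)] with ν hν hrν hnν
    obtain ⟨k, hk, rfl⟩ := List.getElem_of_mem hν
    have h1 := (h.projectStep hf hk).1
    have h2 := (abs_le.mp (hcomp ν _ _ hrν (hnν (k + 1) hk))).1
    rw [mul_div_cancel₀ _ hai.ne', inner_sub_right, htight] at h2
    nlinarith
  rcases hnonpos.eq_or_lt with heq | hlt
  · simp [heq]
  refine ⟨?_, Eventually.of_forall fun ν =>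
    mul_nonpos_of_nonneg_of_nonpos ((h.dualPair hf ν).nonneg i) hnonpos⟩
  have hlt' : ∀ᶠ ν in (U : Filter ℕ),
      ⟪a i, ‖T.x ν - w‖⁻¹ • (T.x ν - w)⟫ < ⟪a i, u⟫ / 2 :=
    hlim.eventually (gt_mem_nhds (by linarith))
  -- As ⟪a_i, u⟫ < 0, the constraint is slack after its projection, so all of `z i` was removed
  -- there: z_i a_i is a single gradient change, hence o(r).
  have hdiv : Tendsto (fun ν => T.z ν i / ‖T.x ν - w‖) U (𝓝 0) := by
    refine Metric.tendsto_nhds.mpr fun ε hε => ?_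
    filter_upwards [hmem, hr, hlt', hnear (-⟪a i, u⟫ / (2 * ‖a i‖)) (by
      have := neg_pos.mpr hlt; positivity), hsteps (ε / 2 * ‖a i‖) (by positivity)]
      with ν hν hrν hltν hnν hsν
    obtain ⟨k, hk, rfl⟩ := List.getElem_of_mem hν
    obtain ⟨-, h1, h2, -⟩ := h.projectStep hf hk
    have h3 := (abs_le.mp (hcomp ν _ _ hrν (hnν (k + 1) hk))).2
    rw [inner_sub_right, htight] at h3
    have h4 : ‖a ((T.order ν)[k])‖ * (-⟪a ((T.order ν)[k]), u⟫ /
        (2 * ‖a ((T.order ν)[k])‖)) = -⟪a ((T.order ν)[k]), u⟫ / 2 := by field_simp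
    rw [h4] at h3
    have h5 : ⟪a ((T.order ν)[k]), T.xInner ν (k + 1)⟫ ≠ b ((T.order ν)[k]) := by
      intro h5
      nlinarith
    have h6 := (hsν k hk).2
    rw [h2, h1.resolve_right h5, sub_zero, norm_smul, Real.norm_eq_abs] at h6
    rw [dist_zero_right, norm_div, norm_norm, Real.norm_eq_abs, div_lt_iff₀ hrν]
    have h7 : |T.z ν ((T.order ν)[k])| ≤ ε / 2 * ‖T.x ν - w‖ :=
      le_of_mul_le_mul_right (by linarith) hai
    nlinarith
  have := hdiv.mul_const ⟪a i, u⟫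
  rw [zero_mul] at this
  exact this.congr fun ν => by ring

/-- The duality gap eventually decreases at a linear rate. -/
theorem exists_linear_rate (h : IsProjectForgetRun f S a b out T)
    (hf : IsBregmanFunction f S) (ha : ∀ i, a i ≠ 0) (hopt : IsOptimalSolution f S a b w)
    (hfeas : ∀ i, ∀ ε > 0, ∀ᶠ ν in atTop, ⟪a i, T.x ν⟫ < b i + ε)
    (htwice : TwiceDifferentiableAt f w)
    (hpos : ∀ v : EuclideanSpace ℝ (Fin d), v ≠ 0 → 0 < ⟪v, hessian f w v⟫) :
    ∃ δ > 0, ∀ᶠ ν in atTop, f w - lagrangian f a b (T.x (ν + 1)) (T.z (ν + 1)) ≤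
      (1 - δ) * (f w - lagrangian f a b (T.x ν) (T.z ν)) := by
  by_contra hcon
  obtain ⟨U, hU, hrate⟩ := exists_ultrafilter_of_not_linear_rate
    (g := fun ν => f w - lagrangian f a b (T.x ν) (T.z ν))
    (fun ν => sub_nonneg.mpr (h.lagrangian_le hf hopt.1 ν)) hcon
  have hz := (h.eventually_z_eq_zero hf hopt hfeas).filter_mono hU
  have hsteps := fun κ (hκ : κ > 0) =>
    h.eventually_steps_le hf hopt hfeas htwice hpos hU hrate hκ
  have hx : Tendsto T.x U (𝓝 w) := by
    refine Metric.tendsto_nhds.mpr fun ε hε => ?_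
    filter_upwards [(h.eventually_dist_inner_optimal_lt hf hopt hfeas hε).filter_mono hU]
      with ν hν using hν 0 (Nat.zero_le _)
  -- The failure with `δ = 1` says that the next gap is positive; hence so is the current one.
  have hr : ∀ᶠ ν in (U : Filter ℕ), 0 < ‖T.x ν - w‖ := by
    filter_upwards [hrate 1 one_pos, (h.eventually_gap_eq hf hopt hfeas).filter_mono hU]
      with ν hν hgap
    rw [norm_pos_iff, sub_ne_zero]
    intro heq
    have h1 := h.monotone_lagrangian hf (Nat.le_succ ν)
    have h2 : bregmanDist f w (T.x ν) = 0 := by rw [heq, bregmanDist_self]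
    simp only [Nat.succ_eq_add_one] at h1
    linarith
  obtain ⟨u, hu1, hu⟩ : ∃ u, ‖u‖ = 1 ∧
      Tendsto (fun ν => ‖T.x ν - w‖⁻¹ • (T.x ν - w)) U (𝓝 u) := by
    obtain ⟨u, hu1, hu⟩ :=
      (isCompact_sphere (0 : EuclideanSpace ℝ (Fin d)) 1).ultrafilter_le_nhds
        (U.map fun ν => ‖T.x ν - w‖⁻¹ • (T.x ν - w)) (by
          rw [le_principal_iff]
          refine mem_map.mpr (hr.mono fun ν hν => ?_)
          simp [norm_smul, norm_pos_iff.mp hν])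
    exact ⟨u, by simpa using hu1, hu⟩
  have hzi := h.tendsto_z_mul_inner_div hf ha hz hr hsteps hu
  have hgw : 0 ≤ ⟪gradient f w, u⟫ := by
    have hlim : Tendsto (fun ν => ⟪gradient f (T.x ν), u⟫) U (𝓝 ⟪gradient f w, u⟫) :=
      (htwice.2.continuousAt.tendsto.comp hx).inner tendsto_const_nhds
    refine ge_of_tendsto hlim ?_
    filter_upwards [eventually_all.mpr fun i => (hzi i).2] with ν hν
    rw [(h.dualPair hf ν).inner_gradient]
    exact neg_nonneg.mpr (Finset.sum_nonpos fun i _ => hν i)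
  have hH : Tendsto (fun ν => ⟪gradient f (T.x ν) - gradient f w, u⟫ / ‖T.x ν - w‖) U
      (𝓝 ⟪hessian f w u, u⟫) := by
    have h1 : Tendsto (fun ν => ‖T.x ν - w‖⁻¹ •
        (gradient f (T.x ν) - gradient f w - hessian f w (T.x ν - w))) U (𝓝 0) := by
      refine tendsto_zero_iff_norm_tendsto_zero.mpr ?_
      have := ((htwice.2.hasFDerivAt.isLittleO.comp_tendsto hx).norm_norm).tendsto_div_nhds_zero
      refine this.congr fun ν => ?_
      simp only [Function.comp_apply, norm_smul, norm_inv, norm_norm, hessian]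
      rw [div_eq_inv_mul]
    have h2 := (h1.add (((hessian f w).continuous.tendsto u).comp hu)).inner (𝕜 := ℝ)
      (tendsto_const_nhds (x := u))
    rw [zero_add] at h2
    refine h2.congr fun ν => ?_
    simp only [Function.comp_apply, map_smul]
    rw [← smul_add, sub_add_cancel, inner_smul_left, div_eq_inv_mul]
    simp
  -- By `hgw`, dropping ⟪∇f w, u⟫ only increases the quotient, and stationarity turns the rest into
  -- the sum of the vanishing terms.
  have hle : ⟪hessian f w u, u⟫ ≤ 0 := by
    have hsum : Tendsto (fun ν => -∑ i, T.z ν i * ⟪a i, u⟫ / ‖T.x ν - w‖) U (𝓝 0) := by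
      simpa using (tendsto_finsetSum Finset.univ fun i _ => (hzi i).1).neg
    refine le_of_tendsto_of_tendsto' hH hsum fun ν => ?_
    rw [inner_sub_left, (h.dualPair hf ν).inner_gradient, ← Finset.sum_div, ← neg_div]
    gcongr
    linarith
  have := hpos u (by rintro rfl; simp at hu1)
  rw [real_inner_comm] at this
  linarith

end IsProjectForgetRun

end LinearRate

/-! ### Convergence of the dual variables -/

section DualConvergence

variable {d : ℕ} {ι : Type*} [Fintype ι] [DecidableEq ι] {f : EuclideanSpace ℝ (Fin d) → ℝ}
  {S : Set (EuclideanSpace ℝ (Fin d))} {a : ι → EuclideanSpace ℝ (Fin d)} {b : ι → ℝ}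
  {out : ℕ → Finset ι} {T : Trace d ι} {w : EuclideanSpace ℝ (Fin d)}

/-- An eventually linearly decreasing sequence is dominated by a geometric one. -/
theorem le_geometric_of_eventually_le {g : ℕ → ℝ} {q : ℝ} (hq : 0 ≤ q) {N : ℕ}
    (h : ∀ ν ≥ N, g (ν + 1) ≤ q * g ν) (n : ℕ) : g (N + n) ≤ q ^ n * g N := by
  induction n with
  | zero => simp
  | succ n ih =>
    calc g (N + n + 1) ≤ q * g (N + n) := h _ (Nat.le_add_right _ _)
      _ ≤ q * (q ^ n * g N) := by gcongr
      _ = q ^ (n + 1) * g N := by ring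

namespace IsProjectForgetRun

/-- The dual variables move by at most a multiple of the square root of the duality gap. -/
theorem exists_dist_zInner_le (h : IsProjectForgetRun f S a b out T)
    (hf : IsBregmanFunction f S) (ha : ∀ i, a i ≠ 0) (hopt : IsOptimalSolution f S a b w)
    (hfeas : ∀ i, ∀ ε > 0, ∀ᶠ ν in atTop, ⟪a i, T.x ν⟫ < b i + ε)
    (htwice : TwiceDifferentiableAt f w)
    (hpos : ∀ v : EuclideanSpace ℝ (Fin d), v ≠ 0 → 0 < ⟪v, hessian f w v⟫) :
    ∃ M : ℝ, 0 ≤ M ∧ ∀ᶠ ν in atTop, ∀ k ≤ (T.order ν).length,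
      dist (T.zInner ν k) (T.z ν) ≤
        M * Real.sqrt (f w - lagrangian f a b (T.x ν) (T.z ν)) := by
  obtain ⟨m, hm, K, hK, hloc⟩ := hf.exists_local_bounds hopt.1.2 htwice hpos
  obtain ⟨ρ, hρ, hb⟩ := hloc 1 one_pos
  -- Each coordinate moves once per iteration, by a gradient change divided by ‖a_i‖; the sum
  -- dominates the largest of these constants.
  set M : ℝ := ∑ i, 2 * K / Real.sqrt m / ‖a i‖ with hM
  have hM0 : 0 ≤ M := Finset.sum_nonneg fun i _ => by positivity
  refine ⟨M, hM0, ?_⟩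
  filter_upwards [h.eventually_dist_inner_optimal_lt hf hopt hfeas hρ] with ν hν k hk
  set s := Real.sqrt (f w - lagrangian f a b (T.x ν) (T.z ν)) with hs
  have hgrad : ∀ q ≤ (T.order ν).length,
      ‖gradient f (T.xInner ν q) - gradient f w‖ ≤ K * (s / Real.sqrt m) := by
    intro q hq
    obtain ⟨h1, -, h2, -⟩ := hb _ (h.dualPair_inner hf hq).mem (hν q hq)
    have h3 := h.bregmanDist_feasible_inner_le hf hopt.1.1 hq
    refine h1.trans ?_
    gcongr
    rw [hs, ← Real.sqrt_div' _ hm.le]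
    refine Real.le_sqrt_of_sq_le ?_
    rw [le_div_iff₀ hm]
    linarith
  refine (dist_pi_le_iff (by positivity)).mpr fun i => ?_
  by_cases hi : i ∈ T.order ν
  swap
  · rw [h.zInner_eq_of_notMem hf hi hk, dist_self]
    positivity
  obtain ⟨k₀, hk₀, rfl⟩ := List.getElem_of_mem hi
  rcases le_or_gt k k₀ with hle | hlt
  · rw [h.zInner_eq_of_le hf hk₀ hle, dist_self]
    positivity
  rw [h.zInner_eq_of_lt hf hk₀ hlt hk, dist_comm, Real.dist_eq]
  have h1 := (h.projectStep hf hk₀).2.2.1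
  have h2 := norm_sub_le_norm_sub_add_norm_sub (gradient f (T.xInner ν (k₀ + 1)))
    (gradient f w) (gradient f (T.xInner ν k₀))
  have h3 := hgrad (k₀ + 1) hk₀
  have h4 := hgrad k₀ hk₀.le
  rw [h1, norm_smul, Real.norm_eq_abs, norm_sub_rev (gradient f w)] at h2
  have hai : 0 < ‖a ((T.order ν)[k₀])‖ := norm_pos_iff.mpr (ha _)
  have h5 : |T.z ν ((T.order ν)[k₀]) - T.z (ν + 1) ((T.order ν)[k₀])| ≤
      2 * K / Real.sqrt m / ‖a ((T.order ν)[k₀])‖ * s := by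
    rw [div_mul_eq_mul_div, le_div_iff₀ hai]
    refine h2.trans ((add_le_add h3 h4).trans (le_of_eq ?_))
    ring
  refine h5.trans (mul_le_mul_of_nonneg_right ?_ (Real.sqrt_nonneg _))
  exact Finset.single_le_sum (f := fun i => 2 * K / Real.sqrt m / ‖a i‖)
    (fun i _ => by positivity) (Finset.mem_univ _)

/-- The dual variables converge as soon as the constraints are asymptotically satisfied. -/
theorem exists_dualConvergesTo (h : IsProjectForgetRun f S a b out T)
    (hf : IsBregmanFunction f S) (ha : ∀ i, a i ≠ 0) (hopt : IsOptimalSolution f S a b w)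
    (hfeas : ∀ i, ∀ ε > 0, ∀ᶠ ν in atTop, ⟪a i, T.x ν⟫ < b i + ε)
    (htwice : TwiceDifferentiableAt f w)
    (hpos : ∀ v : EuclideanSpace ℝ (Fin d), v ≠ 0 → 0 < ⟪v, hessian f w v⟫) :
    ∃ zstar : ι → ℝ, DualConvergesTo T zstar := by
  obtain ⟨M, hM, hdist⟩ := h.exists_dist_zInner_le hf ha hopt hfeas htwice hpos
  obtain ⟨δ, hδ, hrate⟩ := h.exists_linear_rate hf ha hopt hfeas htwice hpos
  set g := fun ν => f w - lagrangian f a b (T.x ν) (T.z ν) with hg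
  have hg0 : ∀ ν, 0 ≤ g ν := fun ν => sub_nonneg.mpr (h.lagrangian_le hf hopt.1 ν)
  -- `δ` may exceed 1, while a square root of the ratio is needed.
  set q := max (1 - δ) 0 with hq
  have hq1 : q < 1 := max_lt (by linarith) one_pos
  have hq0 : 0 ≤ q := le_max_right _ _
  obtain ⟨N, hN⟩ := eventually_atTop.mp (hdist.and hrate)
  have hgeom := le_geometric_of_eventually_le (g := g) hq0 (N := N) fun ν hν =>
    (hN ν hν).2.trans (mul_le_mul_of_nonneg_right (le_max_left _ _) (hg0 ν))
  have hsucc : ∀ n, dist (T.z (n + N)) (T.z (n + 1 + N)) ≤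
      M * Real.sqrt (g N) * Real.sqrt q ^ n := by
    intro n
    have h1 := (hN (n + N) (Nat.le_add_left _ _)).1 _ le_rfl
    rw [← h.next_z, dist_comm, show n + N + 1 = n + 1 + N by omega] at h1
    have h2 : Real.sqrt (g (n + N)) ≤ Real.sqrt q ^ n * Real.sqrt (g N) := by
      refine Real.sqrt_le_iff.mpr ⟨by positivity, ?_⟩
      rw [mul_pow, ← pow_mul, mul_comm n 2, pow_mul, Real.sq_sqrt hq0, Real.sq_sqrt (hg0 N),
        add_comm]
      exact hgeom n
    calc _ ≤ M * Real.sqrt (g (n + N)) := h1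
      _ ≤ M * (Real.sqrt q ^ n * Real.sqrt (g N)) := by gcongr
      _ = _ := by ring
  have hq1' : Real.sqrt q < 1 := by rwa [Real.sqrt_lt' one_pos, one_pow]
  obtain ⟨z', hz'⟩ := cauchySeq_tendsto_of_complete
    (cauchySeq_of_le_geometric (f := fun n => T.z (n + N)) _ _ hq1' hsucc)
  have hz : Tendsto T.z atTop (𝓝 z') := (tendsto_add_atTop_iff_nat N).mp hz'
  refine ⟨z', hz, fun ε hε => ?_⟩
  have hlim : Tendsto (fun ν => M * Real.sqrt (g ν)) atTop (𝓝 0) := by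
    have h1 : Tendsto g atTop (𝓝 0) := by
      simpa using (h.tendsto_lagrangian hf hopt hfeas).const_sub (f w)
    have h2 := (Real.continuous_sqrt.tendsto 0).comp h1
    simpa [Function.comp_def] using h2.const_mul M
  have hev := (hdist.and (hlim.eventually (gt_mem_nhds (half_pos hε)))).and
    (Metric.tendsto_nhds.mp hz (ε / 2) (half_pos hε))
  obtain ⟨N', hN'⟩ := eventually_atTop.mp hev
  refine ⟨N', fun ν hν k hk => ?_⟩
  obtain ⟨⟨h1, h2⟩, h3⟩ := hN' ν hν
  calc dist (T.zInner ν k) z' ≤ dist (T.zInner ν k) (T.z ν) + dist (T.z ν) z' :=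
        dist_triangle _ _ _
    _ < ε / 2 + ε / 2 := add_lt_add (((h1 k hk).trans_lt h2)) h3
    _ = ε := add_halves ε

end IsProjectForgetRun

end DualConvergence

/-! ### Asymptotic feasibility from the oracles -/

section Oracles

variable {d : ℕ} {ι : Type*} {a : ι → EuclideanSpace ℝ (Fin d)} {b : ι → ℝ}

theorem infDist_halfSpace_mul_norm_le {c x : EuclideanSpace ℝ (Fin d)} {β t : ℝ} (ht : 0 ≤ t)
    (h : ⟪c, x⟫ ≤ β + t) : Metric.infDist x (halfSpace c β) * ‖c‖ ≤ t := by
  rcases eq_or_ne c 0 with rfl | hc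
  · simpa using ht
  have hn : 0 < ‖c‖ := norm_pos_iff.mpr hc
  have hmem : x - (t / ‖c‖ ^ 2) • c ∈ halfSpace c β := by
    simp only [halfSpace, mem_ofPred_eq, inner_sub_right, inner_smul_right,
      real_inner_self_eq_norm_sq]
    rw [div_mul_cancel₀ _ (by positivity)]
    linarith
  have h1 := Metric.infDist_le_dist_of_mem (x := x) hmem
  rw [dist_eq_norm, sub_sub_cancel, norm_smul, Real.norm_of_nonneg (by positivity)] at h1
  calc _ ≤ t / ‖c‖ ^ 2 * ‖c‖ * ‖c‖ := by gcongr
    _ = t := by field_simp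

theorem inner_le_add_mul_infDist (hne : (feasibleRegion a b).Nonempty) (i : ι)
    (x : EuclideanSpace ℝ (Fin d)) :
    ⟪a i, x⟫ ≤ b i + ‖a i‖ * Metric.infDist x (feasibleRegion a b) := by
  refine le_of_forall_pos_le_add fun ε hε => ?_
  obtain ⟨y, hy, hxy⟩ := (Metric.infDist_lt_iff hne).mp
    (lt_add_of_pos_right (Metric.infDist x (feasibleRegion a b))
      -- The `+ 1` covers `a i = 0`.
      (show 0 < ε / (‖a i‖ + 1) by positivity))
  have h1 := mem_feasibleRegion_iff.mp hy i
  have h2 := real_inner_le_norm (a i) (x - y)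
  rw [inner_sub_right, ← dist_eq_norm] at h2
  have h3 : ‖a i‖ * (ε / (‖a i‖ + 1)) ≤ ε := by
    rw [← mul_div_assoc, div_le_iff₀ (by positivity)]
    nlinarith [norm_nonneg (a i)]
  have h4 := mul_le_mul_of_nonneg_left hxy.le (norm_nonneg (a i))
  linarith

variable [Fintype ι] [DecidableEq ι] {f : EuclideanSpace ℝ (Fin d) → ℝ}
  {S : Set (EuclideanSpace ℝ (Fin d))} {w : EuclideanSpace ℝ (Fin d)}

/-- With a deterministic separation oracle the constraints are asymptotically satisfied. -/
theorem IsSeparationOracle.eventually_inner_lt {Q : EuclideanSpace ℝ (Fin d) → Finset ι}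
    (hQ : IsSeparationOracle a b Q) (ha : ∀ i, a i ≠ 0) {T : Trace d ι}
    (h : IsProjectForgetRun f S a b (fun ν => Q (T.x ν)) T) (hf : IsBregmanFunction f S)
    (hw : w ∈ feasibleRegion a b ∩ closure S) (i : ι) {ε : ℝ} (hε : 0 < ε) :
    ∀ᶠ ν in atTop, ⟪a i, T.x ν⟫ < b i + ε := by
  obtain ⟨φ, -, hφpos, hφmono, -, hφ⟩ := hQ
  have hai : 0 < ‖a i‖ := norm_pos_iff.mpr (ha i)
  set t := ε / ‖a i‖ with ht
  have ht0 : 0 < t := by positivity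
  have hφt := hφpos t ht0
  -- Every returned half-space is then closer than `φ t`, so monotonicity of `φ` keeps the distance
  -- to the feasible region below `t`.
  have hall : ∀ᶠ ν in atTop, ∀ j, j ∈ Q (T.x ν) →
      ⟪a j, T.x ν⟫ < b j + φ t / 2 * ‖a j‖ :=
    eventually_all.mpr fun j => h.eventually_inner_lt_of_mem_out hf hw j
      (mul_pos (half_pos hφt) (norm_pos_iff.mpr (ha j)))
  filter_upwards [hall] with ν hν
  have hdist : Metric.infDist (T.x ν) (feasibleRegion a b) < t := by
    by_contra hcon
    rw [not_lt] at hcon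
    have hnot : T.x ν ∉ feasibleRegion a b := fun hmem => by
      rw [Metric.infDist_zero_of_mem hmem] at hcon
      linarith
    obtain ⟨j, hj, hle⟩ := hφ _ hnot
    have h1 := hφmono (mem_Ici.mpr ht0.le) (mem_Ici.mpr Metric.infDist_nonneg) hcon
    have haj : 0 < ‖a j‖ := norm_pos_iff.mpr (ha j)
    have h2 := infDist_halfSpace_mul_norm_le (by positivity) (hν j hj).le
    have h3 := le_of_mul_le_mul_right h2 haj
    linarith
  calc ⟪a i, T.x ν⟫ ≤ b i + ‖a i‖ * Metric.infDist (T.x ν) (feasibleRegion a b) :=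
        inner_le_add_mul_infDist ⟨w, hw.1⟩ i _
    _ < b i + ‖a i‖ * t := by gcongr
    _ = b i + ε := by rw [ht, mul_div_cancel₀ _ hai.ne']

variable {Q : EuclideanSpace ℝ (Fin d) → PMF (Finset ι)} {Ω : Type*} {mΩ : MeasurableSpace Ω}
  {P : Measure Ω} {ℱ : Filtration ℕ mΩ} {out : ℕ → Ω → Finset ι} {T : Ω → Trace d ι}

theorem IsRandomProjectForgetRun.measurableSet_mem_out
    (h : IsRandomProjectForgetRun f S a b Q P ℱ out T) (ν : ℕ) (i : ι) :
    MeasurableSet[ℱ (ν + 1)] {ω | i ∈ out ν ω} := by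
  have : {ω | i ∈ out ν ω} = ⋃ L ∈ {L : Finset ι | i ∈ L}, {ω | out ν ω = L} := by
    ext ω; simp
  rw [this]
  exact MeasurableSet.biUnion (to_countable _) fun L _ => h.measurable_out ν L

/-- The conditional probability that the random oracle returns the constraint `i`. -/
theorem IsRandomProjectForgetRun.le_condExp_mem_out [IsProbabilityMeasure P]
    (h : IsRandomProjectForgetRun f S a b Q P ℱ out T) {τ : ℝ≥0∞}
    (hτ : ∀ x i, τ ≤ (Q x).toOuterMeasure {L | i ∈ L}) (ν : ℕ) (i : ι) :
    ∀ᵐ ω ∂P, τ.toReal ≤ (P[{ω | i ∈ out ν ω}.indicator (fun _ => (1 : ℝ)) | ℱ ν]) ω := by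
  have hsum : {ω | i ∈ out ν ω}.indicator (fun _ => (1 : ℝ)) =
      ∑ L with i ∈ L, {ω | out ν ω = L}.indicator (fun _ => (1 : ℝ)) := by
    ext ω
    simp only [Finset.sum_apply, indicator_apply, mem_ofPred_eq]
    rw [Finset.sum_ite_eq]
    simp
  have hint : ∀ L ∈ Finset.univ.filter (fun L : Finset ι => i ∈ L),
      Integrable ({ω | out ν ω = L}.indicator (fun _ => (1 : ℝ))) P := fun L _ =>
    (integrable_const 1).indicator (ℱ.le _ _ (h.measurable_out ν L))
  rw [hsum]
  filter_upwards [condExp_finsetSum hint (ℱ ν), eventually_all.mpr fun L => h.law_out ν L]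
    with ω h1 h2
  rw [h1, Finset.sum_apply, Finset.sum_congr rfl fun L _ => h2 L,
    ← ENNReal.toReal_sum fun L _ => (Q _).apply_ne_top L]
  refine ENNReal.toReal_mono (ENNReal.sum_ne_top.mpr fun L _ => (Q _).apply_ne_top L)
    ((hτ ((T ω).x ν) i).trans (le_of_eq ?_))
  rw [PMF.toOuterMeasure_apply_fintype, Finset.sum_filter]
  simp [indicator_apply]

/-- With a random separation oracle the constraints are almost surely asymptotically satisfied. -/
theorem IsRandomSeparationOracle.ae_eventually_inner_lt [IsProbabilityMeasure P]
    (hQ : IsRandomSeparationOracle Q) (h : IsRandomProjectForgetRun f S a b Q P ℱ out T)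
    (hf : IsBregmanFunction f S) (hw : w ∈ feasibleRegion a b ∩ closure S) (i : ι) {ε : ℝ}
    (hε : 0 < ε) :
    ∀ᵐ ω ∂P, ∀ᶠ ν in atTop, ⟪a i, (T ω).x ν⟫ < b i + ε := by
  obtain ⟨τ, hτ0, hτ⟩ := hQ
  have hτtop : τ ≠ ∞ := by
    refine ne_top_of_le_ne_top ?_ (hτ 0 i)
    rw [PMF.toOuterMeasure_apply_fintype]
    refine ENNReal.sum_ne_top.mpr fun L _ => ?_
    rw [indicator_apply]
    split_ifs
    · exact (Q 0).apply_ne_top L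
    · exact ENNReal.zero_ne_top
  have hτ' : 0 < τ.toReal := ENNReal.toReal_pos hτ0.ne' hτtop
  let V : ℕ → Set Ω := fun ν => {ω | b i + ε ≤ ⟪a i, (T ω).x ν⟫}
  let R : ℕ → Set Ω := fun ν => {ω | i ∈ out ν ω}
  -- The list of iteration `ν` is known only at time `ν + 1`; the shift makes `s` adapted.
  let s : ℕ → Set Ω := fun n => Nat.casesOn n ∅ fun ν => V ν ∩ R ν
  have hV : ∀ ν, MeasurableSet[ℱ ν] (V ν) := fun ν =>
    h.measurable_x ν (isClosed_le continuous_const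
      (continuous_const.inner continuous_id) :
        IsClosed {v : EuclideanSpace ℝ (Fin d) | b i + ε ≤ ⟪a i, v⟫}).measurableSet
  have hR : ∀ ν, MeasurableSet[ℱ (ν + 1)] (R ν) := fun ν => h.measurableSet_mem_out ν i
  have hs : ∀ n, MeasurableSet[ℱ n] (s n)
    | 0 => @MeasurableSet.empty Ω (ℱ 0)
    | ν + 1 => (ℱ.mono (Nat.le_succ ν) _ (hV ν)).inter (hR ν)
  have hcond : ∀ᵐ ω ∂P, ∀ ν, (V ν).indicator (fun _ => τ.toReal) ω ≤
      (P[(s (ν + 1)).indicator (1 : Ω → ℝ) | ℱ ν]) ω := by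
    refine ae_all_iff.mpr fun ν => ?_
    have heq : (s (ν + 1)).indicator (1 : Ω → ℝ) =
        (V ν).indicator ((R ν).indicator fun _ => (1 : ℝ)) := by
      rw [indicator_indicator]; rfl
    have hint : Integrable ((R ν).indicator fun _ => (1 : ℝ)) P :=
      (integrable_const 1).indicator (ℱ.le _ _ (hR ν))
    rw [heq]
    filter_upwards [condExp_indicator hint (hV ν), h.le_condExp_mem_out hτ ν i] with ω h1 h2
    rw [h1]
    exact indicator_le_indicator h2
  -- Lévy's Borel–Cantelli lemma. Being violated and returned happens finitely often on every run,
  -- so the conditional probabilities have bounded sums; each violation contributes at least τ, so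
  -- violations are finite in number.
  filter_upwards [ae_mem_limsup_atTop_iff P hs, hcond] with ω h1 h2
  have h3 : ω ∉ limsup s atTop := by
    rw [mem_limsup_iff_frequently_mem, not_frequently]
    obtain ⟨N, hN⟩ :=
      eventually_atTop.mp ((h.run ω).eventually_inner_lt_of_mem_out hf hw i hε)
    refine eventually_atTop.mpr ⟨N + 1, fun n hn hmem => ?_⟩
    obtain ⟨ν, rfl⟩ : ∃ ν, n = ν + 1 := ⟨n - 1, by omega⟩
    exact (hN ν (Nat.le_of_succ_le_succ hn) hmem.2).not_ge hmem.1
  have h4 : ω ∉ limsup V atTop := by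
    intro h4
    refine h3 (h1.mpr ?_)
    rw [limsup_eq_tendsto_sum_indicator_atTop hτ' V] at h4
    exact tendsto_atTop_mono (fun n => Finset.sum_le_sum fun k _ => h2 k) h4
  rw [mem_limsup_iff_frequently_mem, not_frequently] at h4
  filter_upwards [h4] with ν hν using not_le.mp hν

end Oracles

/-! ### The main theorem -/

theorem mainTheorem4 {d : ℕ} {ι : Type*} [Fintype ι] [DecidableEq ι]
    (S : Set (EuclideanSpace ℝ (Fin d))) (f : EuclideanSpace ℝ (Fin d) → ℝ)
    (a : ι → EuclideanSpace ℝ (Fin d)) (b : ι → ℝ) (ha : ∀ i, a i ≠ 0)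
    (hf : IsBregmanFunction f S)
    (hzone : ∀ i, StronglyZoneConsistent f S (a i) (b i))
    (hx0 : ∃ x0 ∈ S, gradient f x0 = 0)
    (xstar : EuclideanSpace ℝ (Fin d)) (hopt : IsOptimalSolution f S a b xstar)
    (htwice : TwiceDifferentiableAt f xstar)
    (hpos : ∀ v : EuclideanSpace ℝ (Fin d), v ≠ 0 → 0 < ⟪v, hessian f xstar v⟫) :
    (∀ Q : EuclideanSpace ℝ (Fin d) → Finset ι, IsSeparationOracle a b Q →
      ∀ T : Trace d ι, IsProjectForgetRun f S a b (fun ν => Q (T.x ν)) T →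
        ∃ zstar : ι → ℝ, DualConvergesTo T zstar) ∧
    (∀ Q : EuclideanSpace ℝ (Fin d) → PMF (Finset ι), IsRandomSeparationOracle Q →
      ∀ (Ω : Type*) (mΩ : MeasurableSpace Ω) (P : Measure Ω) (_ : IsProbabilityMeasure P)
        (ℱ : Filtration ℕ mΩ) (out : ℕ → Ω → Finset ι) (T : Ω → Trace d ι),
        IsRandomProjectForgetRun f S a b Q P ℱ out T →
          ∀ᵐ ω ∂P, ∃ zstar : ι → ℝ, DualConvergesTo (T ω) zstar) := by
  refine ⟨fun Q hQ T h => ?_, fun Q hQ Ω mΩ P _ ℱ out T h => ?_⟩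
  · exact h.exists_dualConvergesTo hf ha hopt
      (fun i ε hε => hQ.eventually_inner_lt ha h hf hopt.1 i hε) htwice hpos
  -- Countably many tolerances suffice, so the null sets can be united.
  · have hall : ∀ᵐ ω ∂P, ∀ i, ∀ n : ℕ, ∀ᶠ ν in atTop,
        ⟪a i, (T ω).x ν⟫ < b i + 1 / ((n : ℝ) + 1) :=
      ae_all_iff.mpr fun i => ae_all_iff.mpr fun n =>
        hQ.ae_eventually_inner_lt h hf hopt.1 i (by positivity)
    filter_upwards [hall] with ω hω
    refine (h.run ω).exists_dualConvergesTo hf ha hopt (fun i ε hε => ?_) htwice hpos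
    obtain ⟨n, hn⟩ := exists_nat_one_div_lt hε
    exact (hω i n).mono fun ν hν => hν.trans (by linarith)
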